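/- **Proposition (reduction of Hitchin realizations).** All manifolds are smooth, finite dimensional, Hausdorff and second countable; bundle maps and forms are smooth. *Definitions.* For a vector bundle map $a:TM\to TM$ put $\mathcal N_a(X,Y)=[aX,aY]+a^2[X,Y]-a([aX,Y]+[X,aY])$. A complex structure on $M$ is understood as a bundle map $J:TM\to TM$ with $J^2=-\mathrm{Id}$ and $\mathcal N_J=0$; a smooth map $f$ between manifolds with complex structures $J_1,J_2$ is holomorphic if $df\circ J_1=J_2\circ df$. A two-form $\omega$ and $a$ commute if $\omega(aX,Y)=\omega(X,aY)$, and then $\omega_a(X,Y)=\omega(aX,Y)$. A generalized complex structure on $M$ is a bundle map $\mathcal J$ of $\mathcal TM=TM\oplus T^*M$ with $\mathcal J^2=-\mathrm{Id}$ and $[\mathcal J\alpha,\mathcal J\beta]-[\alpha,\beta]-\mathcal J([\mathcal J\alpha,\beta]+[\alpha,\mathcal J\beta])=0$ for all sections $\alpha,\beta$, where $[(X,\xi),(Y,\eta)]=([X,Y],\,L_X\eta-L_Y\xi-\tfrac12 d(i_X\eta-i_Y\xi))$ is the Courant bracket; it has the form $\mathcal J=\begin{pmatrix}a&\pi^\sharp\\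 \sigma_\sharp&-a^*\end{pmatrix}$ with a bivector $\pi$ and a two-form $\sigma$. A map $f:(M_1,\mathcal J_1)\to(M_2,\mathcal J_2)$ is generalized holomorphic if it maps $\pi_1$ to $\pi_2$, $f^*\sigma_2=\sigma_1$ and $df\circ a_1=a_2\circ df$. A Hitchin pair on $S$ is a symplectic form $\omega$ together with a bundle map $a:TS\to TS$ commuting with $\omega$ and such that $d\omega_a=0$; it corresponds to the matrix with entries $a$, $\pi^\sharp=\omega_\sharp^{-1}$ and $\sigma=-(\omega+a^*\omega)$, where $(a^*\omega)(X,Y)=\omega(aX,aY)$. A Hitchin realization of $(M,\mathcal J)$ is a manifold $S$ with a Hitchin pair $(\omega,a)$ and a smooth generalized holomorphic map $\mu:S\to M$. *Statement.* Let $\mu:(S,\omega,a)\to(M,\mathcal J)$ be a Hitchin realization of a generalized complex manifold, let $x\in M$ be a regular value of $\mu$, let $\mathcal C=\mu^{-1}(x)$ (an embedded submanifold of $S$) and let $\mathfrak g_x=\mathrm{Ker}(\pi^\sharp_x)\subset T_x^*M$, where $\pi$ is the bivector of $\mathcal J$. For $\alpha\in\mathfrak g_x$ let $\rho(\alpha)$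 be the vector field on $\mathcal C$ determined by $i_{\rho(\alpha)}\omega=\mu^*\alpha$, and let $\mathcal C/\mathfrak g_x$ be the space of orbits of this infinitesimal action. Suppose that $\mathcal C/\mathfrak g_x$ is smooth, i.e. that it is a (Hausdorff) manifold such that the projection $\mathrm{pr}:\mathcal C\to\mathcal C/\mathfrak g_x$ is a submersion whose fibres, as submanifolds, are the orbits: $\mathrm{Ker}(d_p\mathrm{pr})=\{\rho(\alpha)(p):\alpha\in\mathfrak g_x\}$ for all $p\in\mathcal C$. Then: 1. $a$ restricts to a complex structure $a|_{\mathcal C}$ on $\mathcal C$, and there is a unique two-form $\omega_{\mathcal C}$ on $\mathcal C/\mathfrak g_x$ whose pull-back to $\mathcal C$ is $\omega|_{\mathcal C}$; it is symplectic (the reduced symplectic form). 2. There is a unique complex structure $J_{\mathcal C}$ on $\mathcal C/\mathfrak g_x$ for which $\mathrm{pr}:(\mathcal C,a|_{\mathcal C})\to(\mathcal C/\mathfrak g_x,J_{\mathcal C})$ is holomorphic. 3. $J_{\mathcal C}$ commutes with $\omega_{\mathcal C}$. -/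

import Mathlib

open Set Function Manifold VectorField
open scoped Manifold ContDiff Topology

noncomputable section

namespace HitchinReduction

/-! Manifolds are modelled on a finite dimensional real vector space `E` (no boundary), with model
`𝓘(ℝ, E)`.  Tensor fields are families of (multi)linear maps on the tangent spaces. -/

section Tensors

variable {E : Type*} [NormedAddCommGroup E] [NormedSpace ℝ E]
variable {M : Type*} [TopologicalSpace M] [ChartedSpace E M]

variable (E) in
/-- The tangent space at `p`. -/
abbrev Tan (p : M) : Type _ := TangentSpace 𝓘(ℝ, E) p

variable (E) in
/-- The cotangent space at `p`. -/
abbrev Cot (p : M) : Type _ := Tan E p →L[ℝ] ℝ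

variable (E M) in
/-- Vector fields (not necessarily smooth). -/
abbrev VField : Type _ := ∀ p : M, Tan E p

variable (E M) in
/-- One-forms (not necessarily smooth). -/
abbrev OneForm : Type _ := ∀ p : M, Cot E p

variable (E M) in
/-- `(1,1)`-tensors `a : TM → TM`. -/
abbrev EndField : Type _ := ∀ p : M, Tan E p →L[ℝ] Tan E p

variable (E M) in
/-- Bilinear forms on the tangent spaces, in the form `Ω_♯ : TM → T*M`, `v ↦ Ω(v, ·)`. -/
abbrev BilinField : Type _ := ∀ p : M, Tan E p →L[ℝ] Cot E p

variable [IsManifold 𝓘(ℝ, E) ∞ M]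

/-- The vector field `X` is smooth at `p`. -/
def SmoothVFieldAt (X : VField E M) (p : M) : Prop :=
  ContMDiffAt 𝓘(ℝ, E) (𝓘(ℝ, E).prod 𝓘(ℝ, E)) ∞
    (fun q => Bundle.TotalSpace.mk' E (E := fun q : M => Tan E q) q (X q)) p

/-- The one-form `ξ` is smooth at `p`. -/
def SmoothOneFormAt (ξ : OneForm E M) (p : M) : Prop :=
  ContMDiffAt 𝓘(ℝ, E) (𝓘(ℝ, E).prod 𝓘(ℝ, E →L[ℝ] ℝ)) ∞
    (fun q => Bundle.TotalSpace.mk' (E →L[ℝ] ℝ) (E := fun q : M => Cot E q) q (ξ q)) p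

/-- Smoothness of a `(1,1)`-tensor. -/
def SmoothEnd (a : EndField E M) : Prop :=
  ContMDiff 𝓘(ℝ, E) (𝓘(ℝ, E).prod 𝓘(ℝ, E →L[ℝ] E)) ∞
    (fun q => Bundle.TotalSpace.mk' (E →L[ℝ] E) (E := fun q : M => Tan E q →L[ℝ] Tan E q) q (a q))

/-- Smoothness of a field of bilinear forms on `TM`. -/
def SmoothBilin (Ω : BilinField E M) : Prop :=
  ContMDiff 𝓘(ℝ, E) (𝓘(ℝ, E).prod 𝓘(ℝ, E →L[ℝ] E →L[ℝ] ℝ)) ∞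
    (fun q => Bundle.TotalSpace.mk' (E →L[ℝ] E →L[ℝ] ℝ)
      (E := fun q : M => Tan E q →L[ℝ] Cot E q) q (Ω q))

/-- Smoothness of a field of maps `T*M → TM`. -/
def SmoothCotToTan (P : ∀ p : M, Cot E p →L[ℝ] Tan E p) : Prop :=
  ContMDiff 𝓘(ℝ, E) (𝓘(ℝ, E).prod 𝓘(ℝ, (E →L[ℝ] ℝ) →L[ℝ] E)) ∞
    (fun q => Bundle.TotalSpace.mk' ((E →L[ℝ] ℝ) →L[ℝ] E)
      (E := fun q : M => Cot E q →L[ℝ] Tan E q) q (P q))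

/-- Smoothness of a field of maps `T*M → T*M`. -/
def SmoothCotEnd (P : ∀ p : M, Cot E p →L[ℝ] Cot E p) : Prop :=
  ContMDiff 𝓘(ℝ, E) (𝓘(ℝ, E).prod 𝓘(ℝ, (E →L[ℝ] ℝ) →L[ℝ] (E →L[ℝ] ℝ))) ∞
    (fun q => Bundle.TotalSpace.mk' ((E →L[ℝ] ℝ) →L[ℝ] (E →L[ℝ] ℝ))
      (E := fun q : M => Cot E q →L[ℝ] Cot E q) q (P q))

/-- The Lie bracket of vector fields. -/
abbrev bracket (X Y : VField E M) (p : M) : Tan E p := mlieBracket 𝓘(ℝ, E) X Y p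

/-- The derivative `X(f)` at `p` of a function along a vector field. -/
def deriveAlong (X : VField E M) (f : M → ℝ) (p : M) : ℝ := mvfderiv 𝓘(ℝ, E) f p (X p)

/-- A two-form is closed: `dΩ(X, Y, Z) = 0` for all vector fields, with `dΩ` given by the Koszul
formula.  (The fields need only be smooth at the point under consideration.) -/
def IsClosedForm (Ω : BilinField E M) : Prop :=
  ∀ (p : M) (X Y Z : VField E M), SmoothVFieldAt X p → SmoothVFieldAt Y p → SmoothVFieldAt Z p →
    deriveAlong X (fun q => Ω q (Y q) (Z q)) p + deriveAlong Y (fun q => Ω q (Z q) (X q)) p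
      + deriveAlong Z (fun q => Ω q (X q) (Y q)) p
      - Ω p (bracket X Y p) (Z p) - Ω p (bracket Z X p) (Y p) - Ω p (bracket Y Z p) (X p) = 0

/-- A symplectic form: a smooth, alternating, nondegenerate, closed two-form. -/
structure IsSymplectic (Ω : BilinField E M) : Prop where
  smooth : SmoothBilin Ω
  alternating : ∀ (p : M) (v : Tan E p), Ω p v v = 0
  nondegenerate : ∀ (p : M) (v : Tan E p), (∀ w : Tan E p, Ω p v w = 0) → v = 0
  closed : IsClosedForm Ω

/-- `Ω` and `a` commute: `Ω(aX, Y) = Ω(X, aY)`. -/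
def Commutes (Ω : BilinField E M) (a : EndField E M) : Prop :=
  ∀ (p : M) (v w : Tan E p), Ω p (a p v) w = Ω p v (a p w)

/-- The torsion `N_a(X, Y) = [aX, aY] + a²[X, Y] - a([aX, Y] + [X, aY])`. -/
def torsion (a : EndField E M) (X Y : VField E M) (p : M) : Tan E p :=
  bracket (fun q => a q (X q)) (fun q => a q (Y q)) p + a p (a p (bracket X Y p))
    - a p (bracket (fun q => a q (X q)) Y p + bracket X (fun q => a q (Y q)) p)

/-- A complex structure, as a torsion-free almost complex structure. -/
structure IsComplexStructure (J : EndField E M) : Prop where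
  smooth : SmoothEnd J
  sq : ∀ (p : M) (v : Tan E p), J p (J p v) = -v
  torsion_free : ∀ (p : M) (X Y : VField E M), SmoothVFieldAt X p → SmoothVFieldAt Y p →
    torsion J X Y p = 0

/-- A Hitchin pair: a symplectic form `Ω` and a `(1,1)`-tensor `a` which commute, such that
`Ω_a(X, Y) = Ω(aX, Y)` is closed. -/
structure IsHitchinPair (Ω : BilinField E M) (a : EndField E M) : Prop where
  symplectic : IsSymplectic Ω
  smooth : SmoothEnd a
  commutes : Commutes Ω a
  closed : IsClosedForm (fun p => (Ω p).comp (a p))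

end Tensors

section Generalized

variable {E : Type*} [NormedAddCommGroup E] [NormedSpace ℝ E]
variable {M : Type*} [TopologicalSpace M] [ChartedSpace E M]

variable (E M) in
/-- Bundle maps `𝒯M → 𝒯M` of the generalized tangent bundle `𝒯M = TM ⊕ T*M`. -/
abbrev GenEnd : Type _ := ∀ p : M, (Tan E p × Cot E p) →L[ℝ] (Tan E p × Cot E p)

/-- The block `a : TM → TM`. -/
def compA (𝒥 : GenEnd E M) (p : M) : Tan E p →L[ℝ] Tan E p :=
  (ContinuousLinearMap.fst ℝ (Tan E p) (Cot E p)).comp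
    ((𝒥 p).comp (ContinuousLinearMap.inl ℝ (Tan E p) (Cot E p)))

/-- The block `π^♯ : T*M → TM`. -/
def compPi (𝒥 : GenEnd E M) (p : M) : Cot E p →L[ℝ] Tan E p :=
  (ContinuousLinearMap.fst ℝ (Tan E p) (Cot E p)).comp
    ((𝒥 p).comp (ContinuousLinearMap.inr ℝ (Tan E p) (Cot E p)))

/-- The block `σ_♯ : TM → T*M`. -/
def compSigma (𝒥 : GenEnd E M) (p : M) : Tan E p →L[ℝ] Cot E p :=
  (ContinuousLinearMap.snd ℝ (Tan E p) (Cot E p)).comp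
    ((𝒥 p).comp (ContinuousLinearMap.inl ℝ (Tan E p) (Cot E p)))

/-- The block `T*M → T*M`. -/
def compD (𝒥 : GenEnd E M) (p : M) : Cot E p →L[ℝ] Cot E p :=
  (ContinuousLinearMap.snd ℝ (Tan E p) (Cot E p)).comp
    ((𝒥 p).comp (ContinuousLinearMap.inr ℝ (Tan E p) (Cot E p)))

/-- The coordinate expression of a vector field in the preferred chart at `p`. -/
def vfieldInChart (X : VField E M) (p : M) (y : E) : E :=
  mpullback 𝓘(ℝ, E) 𝓘(ℝ, E) (extChartAt 𝓘(ℝ, E) p).symm X y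

/-- The coordinate expression of a one-form in the preferred chart at `p`. -/
def oneFormInChart (ξ : OneForm E M) (p : M) (y : E) : E →L[ℝ] ℝ :=
  (ξ ((extChartAt 𝓘(ℝ, E) p).symm y)).comp
    (mfderiv 𝓘(ℝ, E) 𝓘(ℝ, E) (extChartAt 𝓘(ℝ, E) p).symm y)

/-- The Lie derivative `L_X ξ` at `p`; in the coordinates of the preferred chart at `p` it is
`(L_X ξ)_j = X^i ∂_i ξ_j + ξ_i ∂_j X^i`. -/
def lieDerivOneForm (X : VField E M) (ξ : OneForm E M) (p : M) : Cot E p :=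
  (fderiv ℝ (oneFormInChart ξ p) (extChartAt 𝓘(ℝ, E) p p)
        (vfieldInChart X p (extChartAt 𝓘(ℝ, E) p p))
      + (oneFormInChart ξ p (extChartAt 𝓘(ℝ, E) p p)).comp
        (fderiv ℝ (vfieldInChart X p) (extChartAt 𝓘(ℝ, E) p p))).comp
    (mvfderiv 𝓘(ℝ, E) (extChartAt 𝓘(ℝ, E) p) p)

/-- The Courant bracket
`[(X, ξ), (Y, η)] = ([X, Y], L_X η - L_Y ξ - (1/2) d(i_X η - i_Y ξ))`. -/
def courant (α β : ∀ p : M, Tan E p × Cot E p) (p : M) : Tan E p × Cot E p :=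
  (bracket (fun q => (α q).1) (fun q => (β q).1) p,
    lieDerivOneForm (fun q => (α q).1) (fun q => (β q).2) p
      - lieDerivOneForm (fun q => (β q).1) (fun q => (α q).2) p
      - (1 / 2 : ℝ) • mvfderiv 𝓘(ℝ, E) (fun q => (β q).2 (α q).1 - (α q).2 (β q).1) p)

variable [IsManifold 𝓘(ℝ, E) ∞ M]

/-- A generalized complex structure: a smooth bundle map `𝒥 : 𝒯M → 𝒯M` with `𝒥² = -Id`
and vanishing Courant torsion. -/
structure IsGenComplex (𝒥 : GenEnd E M) : Prop where
  smooth_a : SmoothEnd (compA 𝒥)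
  smooth_pi : SmoothCotToTan (compPi 𝒥)
  smooth_sigma : SmoothBilin (compSigma 𝒥)
  smooth_d : SmoothCotEnd (compD 𝒥)
  sq : ∀ (p : M) (u : Tan E p × Cot E p), 𝒥 p (𝒥 p u) = -u
  integrable : ∀ (p : M) (α β : ∀ q : M, Tan E q × Cot E q),
    SmoothVFieldAt (fun q => (α q).1) p → SmoothOneFormAt (fun q => (α q).2) p →
    SmoothVFieldAt (fun q => (β q).1) p → SmoothOneFormAt (fun q => (β q).2) p →
    courant (fun q => 𝒥 q (α q)) (fun q => 𝒥 q (β q)) p - courant α β p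
      - 𝒥 p (courant (fun q => 𝒥 q (α q)) β p + courant α (fun q => 𝒥 q (β q)) p) = 0


end Generalized

section HitchinToGen

variable {E : Type*} [NormedAddCommGroup E] [NormedSpace ℝ E]
variable {S : Type*} [TopologicalSpace S] [ChartedSpace E S]

/-- The dual map `a^* : T*S → T*S`, `ξ ↦ ξ ∘ a`. -/
def dualEnd (a : EndField E S) (p : S) : Cot E p →L[ℝ] Cot E p :=
  ContinuousLinearMap.precomp ℝ (a p)

/-- The bivector inverse to a nondegenerate two-form: `π^♯ = (Ω_♯)⁻¹`. -/
def inversePi (Ω : BilinField E S) (p : S) : Cot E p →L[ℝ] Tan E p :=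
  ContinuousLinearMap.inverse (Ω p)

/-- The twist `σ = -(Ω + a^*Ω)` of a Hitchin pair, where `(a^*Ω)(v, w) = Ω(av, aw)`. -/
def twist (Ω : BilinField E S) (a : EndField E S) (p : S) : Tan E p →L[ℝ] Cot E p :=
  -(Ω p + (dualEnd a p).comp ((Ω p).comp (a p)))

/-- The (nondegenerate) generalized complex structure of a Hitchin pair, with matrix
`(a, π^♯; σ_♯, -a^*)`. -/
def hitchinGen (Ω : BilinField E S) (a : EndField E S) : GenEnd E S := fun p =>
  ((a p).coprod (inversePi Ω p)).prod ((twist Ω a p).coprod (-(dualEnd a p)))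

end HitchinToGen

section Maps

variable {E₁ : Type*} [NormedAddCommGroup E₁] [NormedSpace ℝ E₁]
variable {M₁ : Type*} [TopologicalSpace M₁] [ChartedSpace E₁ M₁]
variable {E₂ : Type*} [NormedAddCommGroup E₂] [NormedSpace ℝ E₂]
variable {M₂ : Type*} [TopologicalSpace M₂] [ChartedSpace E₂ M₂]

variable (E₁ E₂) in
/-- The differential `d_p f : T_p M₁ → T_{f p} M₂`. -/
abbrev dmap (f : M₁ → M₂) (p : M₁) : Tan E₁ p →L[ℝ] Tan E₂ (f p) :=
  mfderiv 𝓘(ℝ, E₁) 𝓘(ℝ, E₂) f p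

/-- `f` is generalized holomorphic: it maps `π₁` to `π₂`, `f^*σ₂ = σ₁` and `df ∘ a₁ = a₂ ∘ df`. -/
structure IsGenHolomorphic (𝒥₁ : GenEnd E₁ M₁) (𝒥₂ : GenEnd E₂ M₂) (f : M₁ → M₂) : Prop where
  map_pi : ∀ (p : M₁) (ξ : Cot E₂ (f p)),
    dmap E₁ E₂ f p (compPi 𝒥₁ p (ξ.comp (dmap E₁ E₂ f p))) = compPi 𝒥₂ (f p) ξ
  pull_sigma : ∀ (p : M₁) (v w : Tan E₁ p),
    compSigma 𝒥₂ (f p) (dmap E₁ E₂ f p v) (dmap E₁ E₂ f p w) = compSigma 𝒥₁ p v w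
  map_a : ∀ (p : M₁) (v : Tan E₁ p),
    dmap E₁ E₂ f p (compA 𝒥₁ p v) = compA 𝒥₂ (f p) (dmap E₁ E₂ f p v)

/-- The pull-back `f^*Ω` of a two-form. -/
def pullForm (f : M₁ → M₂) (Ω : BilinField E₂ M₂) (p : M₁) (v w : Tan E₁ p) : ℝ :=
  Ω (f p) (dmap E₁ E₂ f p v) (dmap E₁ E₂ f p w)

/-- The differential of `f` intertwines `a₁` and `a₂`: `df ∘ a₁ = a₂ ∘ df`.  For complex
structures this says that the smooth map `f` is holomorphic; for an inclusion it says that `a₁`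
is the restriction of `a₂`. -/
def Intertwines (a₁ : EndField E₁ M₁) (a₂ : EndField E₂ M₂) (f : M₁ → M₂) : Prop :=
  ∀ (p : M₁) (v : Tan E₁ p), dmap E₁ E₂ f p (a₁ p v) = a₂ (f p) (dmap E₁ E₂ f p v)

/-- `x` is a regular value of `f`. -/
def IsRegularValue (E₁ E₂ : Type*) [NormedAddCommGroup E₁] [NormedSpace ℝ E₁]
    [NormedAddCommGroup E₂] [NormedSpace ℝ E₂] {M₁ M₂ : Type*} [TopologicalSpace M₁]
    [ChartedSpace E₁ M₁] [TopologicalSpace M₂] [ChartedSpace E₂ M₂] (f : M₁ → M₂) (x : M₂) :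
    Prop :=
  ∀ p : M₁, f p = x → Function.Surjective (dmap E₁ E₂ f p)

end Maps

section Reduction

variable {ES : Type*} [NormedAddCommGroup ES] [NormedSpace ℝ ES]
variable {S : Type*} [TopologicalSpace S] [ChartedSpace ES S] [IsManifold 𝓘(ℝ, ES) ∞ S]
variable {EM : Type*} [NormedAddCommGroup EM] [NormedSpace ℝ EM]
variable {M : Type*} [TopologicalSpace M] [ChartedSpace EM M]

/-- A Hitchin realization of `(M, 𝒥)`: a Hitchin pair `(Ω, a)` on `S` and a smooth generalized
holomorphic map `μ : S → M`. -/
structure IsHitchinRealization (Ω : BilinField ES S) (a : EndField ES S) (𝒥 : GenEnd EM M)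
    (μ : S → M) : Prop where
  hitchin : IsHitchinPair Ω a
  smooth : ContMDiff 𝓘(ℝ, ES) 𝓘(ℝ, EM) ∞ μ
  holomorphic : IsGenHolomorphic (hitchinGen Ω a) 𝒥 μ

/-- The isotropy Lie algebra `𝔤_x = Ker (π^♯_x)`, as a subspace of the cotangent space at `x`. -/
def isotropy (𝒥 : GenEnd EM M) (x : M) : Submodule ℝ (Cot EM x) :=
  LinearMap.ker (compPi 𝒥 x).toLinearMap

variable {EC : Type*} [NormedAddCommGroup EC] [NormedSpace ℝ EC]

/-- The inclusion of the level set. -/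
abbrev incl (μ : S → M) (x : M) : μ ⁻¹' {x} → S := Subtype.val

/-- A covector `α` at `x`, at the point `μ p = x`. -/
def covectorAt {μ : S → M} {x : M} (α : Cot EM x) (p : μ ⁻¹' {x}) : Cot EM (μ (p : S)) :=
  (show x = μ (p : S) from (p.2 : μ (p : S) = x).symm) ▸ α

/-- The tangent vector `v` of `𝒞 = μ⁻¹(x)` at `p` is the value `ρ(α)(p)` of the infinitesimal
action, i.e. it solves the moment map equation `i_v Ω = μ^*α` at `p`. -/
def IsAction (Ω : BilinField ES S) {μ : S → M} {x : M} [ChartedSpace EC (μ ⁻¹' {x})]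
    (α : Cot EM x) (p : μ ⁻¹' {x}) (v : Tan EC p) : Prop :=
  Ω (p : S) (dmap EC ES (incl μ x) p v) = (covectorAt α p).comp (dmap ES EM μ (p : S))

variable (EC) in
/-- The orbit relation of the infinitesimal action of `𝔤_x` on `𝒞 = μ⁻¹(x)`: it is generated by
`γ 0 ∼ γ 1` for the integral curves `γ : [0, 1] → 𝒞` of the vector fields `ρ(α)`, `α ∈ 𝔤_x`. -/
def orbitSetoid (Ω : BilinField ES S) (𝒥 : GenEnd EM M) (μ : S → M) (x : M)
    [ChartedSpace EC (μ ⁻¹' {x})] : Setoid (μ ⁻¹' {x}) :=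
  Relation.EqvGen.setoid fun p q =>
    ∃ α ∈ isotropy 𝒥 x, ∃ V : VField EC (μ ⁻¹' {x}), (∀ r, IsAction Ω α r (V r)) ∧
      ∃ γ : ℝ → μ ⁻¹' {x}, IsMIntegralCurveOn (I := 𝓘(ℝ, EC)) γ V (Icc 0 1) ∧ γ 0 = p ∧ γ 1 = q

variable (EC) in
/-- The orbit space `𝒞/𝔤_x`, with the quotient topology. -/
abbrev OrbitSpace (Ω : BilinField ES S) (𝒥 : GenEnd EM M) (μ : S → M) (x : M)
    [ChartedSpace EC (μ ⁻¹' {x})] : Type _ :=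
  Quotient (orbitSetoid EC Ω 𝒥 μ x)

variable (EC) in
/-- The projection `𝒞 → 𝒞/𝔤_x`. -/
abbrev proj (Ω : BilinField ES S) (𝒥 : GenEnd EM M) (μ : S → M) (x : M)
    [ChartedSpace EC (μ ⁻¹' {x})] : μ ⁻¹' {x} → OrbitSpace EC Ω 𝒥 μ x :=
  Quotient.mk (orbitSetoid EC Ω 𝒥 μ x)

/-- The orbit space `𝒞/𝔤_x`, with the given smooth structure, is a smooth quotient: the orbits are
the leaves of a simple foliation, given by `𝒞 → 𝒞/𝔤_x`.  That is, the projection is a smooth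
submersion and its fibres, as submanifolds, are the orbits: `Ker (d_p pr) = ρ(𝔤_x)(p)`. -/
structure IsSmoothQuotient (Ω : BilinField ES S) (𝒥 : GenEnd EM M) (μ : S → M) (x : M)
    [ChartedSpace EC (μ ⁻¹' {x})]
    {EQ : Type*} [NormedAddCommGroup EQ] [NormedSpace ℝ EQ]
    [ChartedSpace EQ (OrbitSpace EC Ω 𝒥 μ x)] : Prop where
  submersion : IsSubmersion 𝓘(ℝ, EC) 𝓘(ℝ, EQ) ∞ (proj EC Ω 𝒥 μ x)
  vertical : ∀ (p : μ ⁻¹' {x}) (v : Tan EC p),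
    dmap EC EQ (proj EC Ω 𝒥 μ x) p v = 0 ↔ ∃ α ∈ isotropy 𝒥 x, IsAction Ω α p v

end Reduction

end HitchinReduction

end

open HitchinReduction

/-! Write `𝒞 = μ⁻¹(x)`. By regularity its tangent spaces are the kernels of `dμ`
(`exists_dmap_incl_eq`), and each component of generalized holomorphy contributes one fact.

From `dμ ∘ a = a_M ∘ dμ`, the tensor `a` preserves `Ker dμ`, so it restricts to `𝒞`. From `μ^*σ_M =
σ = -(Ω + a^*Ω)`, the twist `σ` is annihilated by `Ker dμ`; commutation and nondegeneracy of `Ω`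
turn this into `a² = -1` there (`IsHitchinRealization.end_end`). Closedness of `Ω` and `Ω_a` gives
`Ω(N_a(u, v), w) = dσ(u, v, w)` (`IsHitchinPair.apply_torsionAt`), and `dσ = μ^*dσ_M` vanishes as
soon as `u` lies in `Ker dμ`; hence `a` is torsion-free on `𝒞`. Finally, `μ` maps `Ω⁻¹` to `π`,
which identifies the kernel of `Ω|_𝒞` with the directions of the action of `𝔤_x`, that is, with the
vertical vectors of `pr` (`IsHitchinRealization.dmap_proj_eq_zero_iff`).

A closed two-form annihilated by the vertical vectors is invariant along vertical curves by Cartan's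
formula, and the orbits are connected by such curves, so the form descends
(`exists_descended_form`). Applied to `Ω|_𝒞` this gives `Ω_𝒞`, which is nondegenerate because the
kernel of `Ω|_𝒞` is exactly vertical. Applied to `Ω_a|_𝒞` it gives a second skew form `B_𝒞`, and
`J_𝒞 = Ω_𝒞⁻¹ B_𝒞` is `pr`-related to `a|_𝒞`. Therefore `J_𝒞` inherits its square and its vanishing
torsion from `a|_𝒞`, and it commutes with `Ω_𝒞` because `B_𝒞` is skew. Uniqueness holds because `pr`
and its differentials are surjective.

Torsion and exterior derivative are handled as tensors computed at each point in the preferred chart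
at that point, where the coordinate frame is the identity. -/

noncomputable section

namespace HitchinReduction

/-! ### Torsion and exterior derivative on a vector space. -/

section Flat

variable {E : Type*} [NormedAddCommGroup E] [NormedSpace ℝ E]
variable {F : Type*} [NormedAddCommGroup F] [NormedSpace ℝ F]

/-- The torsion at `y` of a `(1,1)`-tensor on a vector space. -/
def flatTorsion (A : E → E →L[ℝ] E) (y u v : E) : E :=
  fderiv ℝ A y (A y u) v - fderiv ℝ A y (A y v) u - A y (fderiv ℝ A y u v)
    + A y (fderiv ℝ A y v u)

/-- The exterior derivative at `y` of a two-form on a vector space. -/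
def flatExtDeriv (η : E → E →L[ℝ] E →L[ℝ] ℝ) (y u v w : E) : ℝ :=
  fderiv ℝ η y u v w + fderiv ℝ η y v w u + fderiv ℝ η y w u v

theorem fderiv_clm_apply_const {G : Type*} [NormedAddCommGroup G] [NormedSpace ℝ G]
    {A : E → F →L[ℝ] G} {y : E} (hA : DifferentiableAt ℝ A y) (u : E) (v : F) :
    fderiv ℝ (fun z => A z v) y u = fderiv ℝ A y u v := by
  have := (hA.hasFDerivAt.clm_apply (hasFDerivAt_const v y)).fderiv
  rw [this]; simp

/-- Differentiating the intertwining relation (`key`) and combining four instances of it, all second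
derivatives of `f` cancel by their symmetry. -/
theorem flatTorsion_of_intertwines {f : E → F} {A : E → E →L[ℝ] E} {B : F → F →L[ℝ] F} {y : E}
    (hf : ContDiffAt ℝ 2 f y) (hA : DifferentiableAt ℝ A y) (hB : DifferentiableAt ℝ B (f y))
    (h : ∀ᶠ z in 𝓝 y, ∀ v, fderiv ℝ f z (A z v) = B (f z) (fderiv ℝ f z v)) (u v : E) :
    fderiv ℝ f y (flatTorsion A y u v)
      = flatTorsion B (f y) (fderiv ℝ f y u) (fderiv ℝ f y v) := by
  have hf1 : HasFDerivAt f (fderiv ℝ f y) y := (hf.differentiableAt (by norm_num)).hasFDerivAt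
  have hf2 : HasFDerivAt (fderiv ℝ f) (fderiv ℝ (fderiv ℝ f) y) y :=
    ((hf.fderiv_right (m := 1) (by norm_num)).differentiableAt (by norm_num)).hasFDerivAt
  have hs : ∀ a b, fderiv ℝ (fderiv ℝ f) y a b = fderiv ℝ (fderiv ℝ f) y b a := fun a b =>
    (hf.isSymmSndFDerivAt (by simp)).eq a b
  have key : ∀ w v : E, fderiv ℝ (fderiv ℝ f) y w (A y v) + fderiv ℝ f y (fderiv ℝ A y w v)
      = fderiv ℝ B (f y) (fderiv ℝ f y w) (fderiv ℝ f y v)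
        + B (f y) (fderiv ℝ (fderiv ℝ f) y w v) := by
    intro w v
    have h1 := hf2.clm_apply (hA.hasFDerivAt.clm_apply (hasFDerivAt_const v y))
    have h2 := (hB.hasFDerivAt.comp y hf1).clm_apply (hf2.clm_apply (hasFDerivAt_const v y))
    have h3 : (fun z => fderiv ℝ f z (A z v)) =ᶠ[𝓝 y] fun z => B (f z) (fderiv ℝ f z v) := by
      filter_upwards [h] with z hz using hz v
    have h4 := h1.unique (h2.congr_of_eventuallyEq h3)
    have h5 := congrArg (fun T => T w) h4
    simp at h5
    rw [add_comm, h5, add_comm]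
  have h0 := h.self_of_nhds
  have k1 := key (A y u) v
  have k2 := key (A y v) u
  have k3 := congrArg (B (f y)) (key u v)
  have k4 := congrArg (B (f y)) (key v u)
  simp only [flatTorsion, map_add, map_sub, h0] at *
  rw [hs (A y v) (A y u)] at k2
  rw [hs v u] at k4
  rw [hs u (A y v)] at k3
  rw [hs v (A y u)] at k4
  linear_combination (norm := module) k1 - k2 - k3 + k4

theorem hasFDerivAt_bilin_apply {η : E → F →L[ℝ] F →L[ℝ] ℝ} {y : E} {V W : E → F}
    (hη : DifferentiableAt ℝ η y) (hV : DifferentiableAt ℝ V y) (hW : DifferentiableAt ℝ W y)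
    (u : E) :
    fderiv ℝ (fun z => η z (V z) (W z)) y u
      = fderiv ℝ η y u (V y) (W y) + η y (fderiv ℝ V y u) (W y) + η y (V y) (fderiv ℝ W y u) := by
  have := ((hη.hasFDerivAt.clm_apply hV.hasFDerivAt).clm_apply hW.hasFDerivAt).fderiv
  rw [this]; simp; ring

/-- The product rule produces six terms with a second derivative of `f`; they cancel in pairs by
symmetry of that derivative and skewness of `η` at `f y`. -/
theorem flatExtDeriv_pullback {f : E → F} {θ : E → E →L[ℝ] E →L[ℝ] ℝ}
    {η : F → F →L[ℝ] F →L[ℝ] ℝ} {y : E}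
    (hf : ContDiffAt ℝ 2 f y) (hθ : DifferentiableAt ℝ θ y) (hη : DifferentiableAt ℝ η (f y))
    (hskew : ∀ a b, η (f y) a b = - η (f y) b a)
    (h : ∀ᶠ z in 𝓝 y, ∀ v w, θ z v w = η (f z) (fderiv ℝ f z v) (fderiv ℝ f z w)) (u v w : E) :
    flatExtDeriv θ y u v w
      = flatExtDeriv η (f y) (fderiv ℝ f y u) (fderiv ℝ f y v) (fderiv ℝ f y w) := by
  have hf1 : HasFDerivAt f (fderiv ℝ f y) y := (hf.differentiableAt (by norm_num)).hasFDerivAt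
  have hf2 : DifferentiableAt ℝ (fderiv ℝ f) y :=
    (hf.fderiv_right (m := 1) (by norm_num)).differentiableAt (by norm_num)
  have hs : ∀ a b, fderiv ℝ (fderiv ℝ f) y a b = fderiv ℝ (fderiv ℝ f) y b a := fun a b =>
    (hf.isSymmSndFDerivAt (by simp)).eq a b
  have key : ∀ u v w : E, fderiv ℝ θ y u v w
      = fderiv ℝ η (f y) (fderiv ℝ f y u) (fderiv ℝ f y v) (fderiv ℝ f y w)
        + η (f y) (fderiv ℝ (fderiv ℝ f) y u v) (fderiv ℝ f y w)
        + η (f y) (fderiv ℝ f y v) (fderiv ℝ (fderiv ℝ f) y u w) := by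
    intro u v w
    have h1 := hasFDerivAt_bilin_apply hθ (differentiableAt_const v) (differentiableAt_const w) u
    have hc := HasFDerivAt.comp (G := F →L[ℝ] F →L[ℝ] ℝ) y hη.hasFDerivAt hf1
    have h2 := hasFDerivAt_bilin_apply hc.differentiableAt
      (hf2.clm_apply (differentiableAt_const v)) (hf2.clm_apply (differentiableAt_const w)) u
    have h3 : (fun z => θ z v w) =ᶠ[𝓝 y]
        fun z => (η ∘ f) z (fderiv ℝ f z v) (fderiv ℝ f z w) := by
      filter_upwards [h] with z hz using hz v w
    rw [h3.fderiv_eq, h2, hc.fderiv, fderiv_clm_apply_const hf2, fderiv_clm_apply_const hf2] at h1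
    simpa using h1.symm
  simp only [flatExtDeriv, key]
  rw [hskew (fderiv ℝ f y v) (fderiv ℝ (fderiv ℝ f) y u w),
    hskew (fderiv ℝ f y w) (fderiv ℝ (fderiv ℝ f) y v u),
    hskew (fderiv ℝ f y u) (fderiv ℝ (fderiv ℝ f) y w v), hs u w, hs v u, hs w v]
  ring

/-- For a closed form commuting with `A` and such that `η(A·,·)` is closed, the torsion of `A` is
minus the exterior derivative of `η(A·,A·)`. -/
theorem bilin_flatTorsion {η θ : E → E →L[ℝ] E →L[ℝ] ℝ} {A : E → E →L[ℝ] E} {y : E}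
    (hη : DifferentiableAt ℝ η y) (hA : DifferentiableAt ℝ A y) (hθ : DifferentiableAt ℝ θ y)
    (hskew : ∀ᶠ z in 𝓝 y, ∀ u v, η z u v = - η z v u)
    (hcomm : ∀ᶠ z in 𝓝 y, ∀ u v, η z (A z u) v = η z u (A z v))
    (hdη : ∀ u v w, flatExtDeriv η y u v w = 0)
    (hdηA : ∀ u v w, flatExtDeriv (fun z => (η z).comp (A z)) y u v w = 0)
    (h : ∀ᶠ z in 𝓝 y, ∀ u v, θ z u v = η z (A z u) (A z v)) (u v w : E) :
    η y (flatTorsion A y u v) w = - flatExtDeriv θ y u v w := by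
  have hApp : ∀ x : E, DifferentiableAt ℝ (fun z => A z x) y := fun x =>
    hA.clm_apply (differentiableAt_const x)
  have kA : ∀ x a b, fderiv ℝ (fun z => (η z).comp (A z)) y x a b
      = fderiv ℝ η y x (A y a) b + η y (fderiv ℝ A y x a) b := by
    intro x a b
    have h1 := hasFDerivAt_bilin_apply (hη.clm_comp hA) (differentiableAt_const a)
      (differentiableAt_const b) x
    have h2 := hasFDerivAt_bilin_apply hη (hApp a) (differentiableAt_const b) x
    simp only [ContinuousLinearMap.comp_apply, fderiv_fun_const] at h1
    rw [h2, fderiv_clm_apply_const hA] at h1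
    simpa using h1.symm
  have kθ : ∀ x a b, fderiv ℝ θ y x a b = fderiv ℝ η y x (A y a) (A y b)
      + η y (fderiv ℝ A y x a) (A y b) + η y (A y a) (fderiv ℝ A y x b) := by
    intro x a b
    have h1 := hasFDerivAt_bilin_apply hθ (differentiableAt_const a) (differentiableAt_const b) x
    have h2 := hasFDerivAt_bilin_apply hη (hApp a) (hApp b) x
    have h3 : (fun z => θ z a b) =ᶠ[𝓝 y] fun z => η z (A z a) (A z b) := by
      filter_upwards [h] with z hz using hz a b
    rw [h3.fderiv_eq, h2, fderiv_clm_apply_const hA, fderiv_clm_apply_const hA] at h1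
    simpa using h1.symm
  have kS : ∀ x a b, fderiv ℝ η y x a b = - fderiv ℝ η y x b a := by
    intro x a b
    have h1 := hasFDerivAt_bilin_apply hη (differentiableAt_const a) (differentiableAt_const b) x
    have h2 := hasFDerivAt_bilin_apply hη (differentiableAt_const b) (differentiableAt_const a) x
    have h3 : (fun z => η z a b) =ᶠ[𝓝 y] fun z => - η z b a := by
      filter_upwards [hskew] with z hz using hz a b
    rw [h3.fderiv_eq, fderiv_fun_neg] at h1
    simp [h2] at h1
    linarith
  have kC : ∀ x a b, fderiv ℝ η y x (A y a) b + η y (fderiv ℝ A y x a) b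
      = fderiv ℝ η y x a (A y b) + η y a (fderiv ℝ A y x b) := by
    intro x a b
    have h1 := hasFDerivAt_bilin_apply hη (hApp a) (differentiableAt_const b) x
    have h2 := hasFDerivAt_bilin_apply hη (differentiableAt_const a) (hApp b) x
    have h3 : (fun z => η z (A z a) b) =ᶠ[𝓝 y] fun z => η z a (A z b) := by
      filter_upwards [hcomm] with z hz using hz a b
    rw [h3.fderiv_eq, h2, fderiv_clm_apply_const hA, fderiv_clm_apply_const hA] at h1
    simpa using h1.symm
  have s0 := hskew.self_of_nhds
  have c0 := hcomm.self_of_nhds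
  simp only [flatExtDeriv, kA, kθ] at *
  simp only [flatTorsion, map_add, map_sub, _root_.add_apply,
    _root_.sub_apply, c0]
  -- The three closedness relations carrying the identity; what remains follows from skewness and
  -- commutation at `y` together with their derivatives `kS` and `kC`.
  have e1 := hdη (A y u) (A y v) w
  have e2 := hdηA (A y u) v w
  have e3 := hdηA (A y v) w u
  linarith [kC w (A y u) v, kC u (A y v) w, kC (A y v) w u,
    kS (A y v) w (A y u), kS w (A y v) (A y u), kS u (A y v) (A y w), kS v (A y w) (A y u),
    kS w (A y u) (A y v), s0 (fderiv ℝ A y v w) (A y u), s0 w (fderiv ℝ A y (A y v) u),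
    s0 (A y v) (fderiv ℝ A y u w), s0 (fderiv ℝ A y w u) (A y v), s0 (fderiv ℝ A y w v) (A y u),
    s0 (fderiv ℝ A y u v) (A y w), s0 (fderiv ℝ A y v u) (A y w),
    c0 v (fderiv ℝ A y u w), c0 w (fderiv ℝ A y v u), c0 u (fderiv ℝ A y w v),
    c0 u (fderiv ℝ A y v w), c0 v (fderiv ℝ A y w u), c0 w (fderiv ℝ A y u v)]


/-- The right inverse `K` at `y` is corrected to `K (dP_z K)⁻¹` at nearby `z`, where `dP_z K` stays
invertible. The result lifts constant vectors of the target to a differentiable family of fields. -/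
theorem eventually_comp_right_inverse {P : E → F} {y : E} (K : F →L[ℝ] E)
    (hP : ContDiffAt ℝ 2 P y) (hK : ∀ a, fderiv ℝ P y (K a) = a) [CompleteSpace F] :
    ∃ R : E → F →L[ℝ] E, DifferentiableAt ℝ R y ∧ ∀ᶠ z in 𝓝 y, ∀ a, fderiv ℝ P z (R z a) = a := by
  have hf2 : DifferentiableAt ℝ (fderiv ℝ P) y :=
    (hP.fderiv_right (m := 1) (by norm_num)).differentiableAt (by norm_num)
  have hd : DifferentiableAt ℝ (fun z => (fderiv ℝ P z).comp K) y :=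
    hf2.clm_comp (differentiableAt_const K)
  have hid : (fderiv ℝ P y).comp K = ContinuousLinearMap.id ℝ F := by ext a; simp [hK]
  have hinv : ((fderiv ℝ P y).comp K).IsInvertible := by
    rw [hid]; exact ⟨ContinuousLinearEquiv.refl ℝ F, rfl⟩
  refine ⟨fun z => K.comp ((fderiv ℝ P z).comp K).inverse, ?_, ?_⟩
  · refine (differentiableAt_const K).clm_comp ?_
    have h1 : DifferentiableAt ℝ (ContinuousLinearMap.inverse : (F →L[ℝ] F) → (F →L[ℝ] F))
        ((fderiv ℝ P y).comp K) := (hinv.contDiffAt_map_inverse (n := 1)).differentiableAt (by norm_num)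
    exact h1.comp y hd
  · have : ∀ᶠ T in 𝓝 ((fderiv ℝ P y).comp K), T.IsInvertible := by
      obtain ⟨e, he⟩ := hinv
      rw [← he]
      exact ContinuousLinearEquiv.nhds e
    filter_upwards [hd.continuousAt.eventually this] with z hz a
    exact hz.self_apply_inverse a

/-- A closed two-form which vanishes on the vertical vectors of a submersion `P` is invariant in
the vertical directions. -/
theorem fderiv_vertical_eq_zero {θ : E → E →L[ℝ] E →L[ℝ] ℝ} {P : E → F} {R : E → F →L[ℝ] E}
    {y : E} (hP : ContDiffAt ℝ 2 P y) (hθ : DifferentiableAt ℝ θ y) (hR : DifferentiableAt ℝ R y)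
    (hPR : ∀ᶠ z in 𝓝 y, ∀ a, fderiv ℝ P z (R z a) = a)
    (hskew : ∀ᶠ z in 𝓝 y, ∀ u v, θ z u v = - θ z v u)
    (hd : ∀ u v w, flatExtDeriv θ y u v w = 0)
    (hker : ∀ᶠ z in 𝓝 y, ∀ k v, fderiv ℝ P z k = 0 → θ z k v = 0)
    {k : E} (hk : fderiv ℝ P y k = 0) (a b : F) :
    fderiv ℝ (fun z => θ z (R z a) (R z b)) y k = 0 := by
  have hf2 : DifferentiableAt ℝ (fderiv ℝ P) y :=
    (hP.fderiv_right (m := 1) (by norm_num)).differentiableAt (by norm_num)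
  have hs : ∀ a b, fderiv ℝ (fderiv ℝ P) y a b = fderiv ℝ (fderiv ℝ P) y b a := fun a b =>
    (hP.isSymmSndFDerivAt (by simp)).eq a b
  have hRa : ∀ c, DifferentiableAt ℝ (fun z => R z c) y := fun c =>
    hR.clm_apply (differentiableAt_const c)
  -- the vertical extension of `k`
  have hkd : DifferentiableAt ℝ (fun z => k - R z (fderiv ℝ P z k)) y :=
    (differentiableAt_const k).sub (hR.clm_apply (hf2.clm_apply (differentiableAt_const k)))
  have hkv : ∀ᶠ z in 𝓝 y, fderiv ℝ P z (k - R z (fderiv ℝ P z k)) = 0 := by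
    filter_upwards [hPR] with z hz
    rw [map_sub, hz, sub_self]
  have hprod : ∀ (V : E → E) (hV : DifferentiableAt ℝ V y) (u : E),
      fderiv ℝ (fun z => fderiv ℝ P z (V z)) y u
        = fderiv ℝ (fderiv ℝ P) y u (V y) + fderiv ℝ P y (fderiv ℝ V y u) := by
    intro V hV u
    rw [(hf2.hasFDerivAt.clm_apply hV.hasFDerivAt).fderiv]
    simp [add_comm]
  have hk0 : k - R y (fderiv ℝ P y k) = k := by simp [hk]
  have e1 : ∀ u, fderiv ℝ (fderiv ℝ P) y u k
      + fderiv ℝ P y (fderiv ℝ (fun z => k - R z (fderiv ℝ P z k)) y u) = 0 := by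
    intro u
    have h := hprod _ hkd u
    have hc : (fun z => fderiv ℝ P z (k - R z (fderiv ℝ P z k))) =ᶠ[𝓝 y] fun _ => 0 := hkv
    rw [hc.fderiv_eq, hk0] at h
    simpa using h.symm
  have e2 : ∀ c u, fderiv ℝ (fderiv ℝ P) y u (R y c)
      + fderiv ℝ P y (fderiv ℝ (fun z => R z c) y u) = 0 := by
    intro c u
    have h := hprod _ (hRa c) u
    have hc : (fun z => fderiv ℝ P z (R z c)) =ᶠ[𝓝 y] fun _ => c := by
      filter_upwards [hPR] with z hz using hz c
    rw [hc.fderiv_eq] at h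
    simpa using h.symm
  have e3 : ∀ u v, fderiv ℝ θ y u k v
      + θ y (fderiv ℝ (fun z => k - R z (fderiv ℝ P z k)) y u) v = 0 := by
    intro u v
    have h := hasFDerivAt_bilin_apply hθ hkd (differentiableAt_const v) u
    have hc : (fun z => θ z (k - R z (fderiv ℝ P z k)) v) =ᶠ[𝓝 y] fun _ => 0 := by
      filter_upwards [hker, hkv] with z hz hz' using hz _ _ hz'
    rw [hc.fderiv_eq, hk0] at h
    simpa using h.symm
  -- The Lie bracket of the vertical field with the lift of the constant field `c` is again
  -- vertical, since the former is `P`-related to zero; so `θ` annihilates it.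
  have e4 : ∀ c v, θ y (fderiv ℝ (fun z => R z c) y k) v
      = θ y (fderiv ℝ (fun z => k - R z (fderiv ℝ P z k)) y (R y c)) v := by
    intro c v
    rw [← sub_eq_zero, ← _root_.sub_apply, ← map_sub]
    apply hker.self_of_nhds
    rw [map_sub]
    have h1 := e1 (R y c)
    have h2 := e2 c k
    rw [hs k] at h2
    rw [← h1] at h2
    rw [sub_eq_zero]
    exact add_left_cancel h2
  have hS : ∀ x a b, fderiv ℝ θ y x a b = - fderiv ℝ θ y x b a := by
    intro x a b
    have h1 := hasFDerivAt_bilin_apply hθ (differentiableAt_const a) (differentiableAt_const b) x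
    have h2 := hasFDerivAt_bilin_apply hθ (differentiableAt_const b) (differentiableAt_const a) x
    have h3 : (fun z => θ z a b) =ᶠ[𝓝 y] fun z => - θ z b a := by
      filter_upwards [hskew] with z hz using hz a b
    rw [h3.fderiv_eq, fderiv_fun_neg] at h1
    simp [h2] at h1
    linarith
  have s0 := hskew.self_of_nhds
  -- Cartan's formula in coordinates: `L_k θ = i_k dθ + d(i_k θ)`, where both terms vanish.
  rw [hasFDerivAt_bilin_apply hθ (hRa a) (hRa b) k, s0 (R y a), e4, e4]
  have h := hd k (R y a) (R y b)
  rw [flatExtDeriv] at h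
  linarith [e3 (R y a) (R y b), e3 (R y b) (R y a), hS (R y a) (R y b) k]

end Flat

/-! ### Tensors, brackets and closedness in charts. -/

section Charts

variable {E : Type*} [NormedAddCommGroup E] [NormedSpace ℝ E]
variable {M : Type*} [TopologicalSpace M] [ChartedSpace E M]

/-- The derivative of the inverse of the preferred chart at `p`. -/
def chartFrame (p : M) (y : E) : E →L[ℝ] E :=
  mfderiv 𝓘(ℝ, E) 𝓘(ℝ, E) (extChartAt 𝓘(ℝ, E) p).symm y

/-- The coordinate expression of a `(1,1)`-tensor in the preferred chart at `p`. -/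
def endInChart (a : EndField E M) (p : M) (y : E) : E →L[ℝ] E :=
  (chartFrame p y).inverse.comp
    ((show E →L[ℝ] E from a ((extChartAt 𝓘(ℝ, E) p).symm y)).comp (chartFrame p y))

/-- The coordinate expression of a field of bilinear forms in the preferred chart at `p`. -/
def bilinInChart (Ω : BilinField E M) (p : M) (y : E) : E →L[ℝ] E →L[ℝ] ℝ :=
  (ContinuousLinearMap.precomp ℝ (chartFrame p y)).comp
    ((show E →L[ℝ] E →L[ℝ] ℝ from Ω ((extChartAt 𝓘(ℝ, E) p).symm y)).comp (chartFrame p y))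

theorem bilinInChart_apply (Ω : BilinField E M) (p : M) (y v w : E) :
    bilinInChart Ω p y v w
      = Ω ((extChartAt 𝓘(ℝ, E) p).symm y) (chartFrame p y v) (chartFrame p y w) := rfl

theorem chartFrame_eq (p : M) (y : E) : chartFrame p y
    = mfderivWithin 𝓘(ℝ, E) 𝓘(ℝ, E) (extChartAt 𝓘(ℝ, E) p).symm (range 𝓘(ℝ, E)) y := by
  rw [modelWithCornersSelf_coe, range_id, mfderivWithin_univ]; rfl

theorem chart_target_mem_nhds (p : M) :
    (extChartAt 𝓘(ℝ, E) p).target ∈ 𝓝 (extChartAt 𝓘(ℝ, E) p p) :=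
  extChartAt_target_mem_nhds p

variable [IsManifold 𝓘(ℝ, E) ∞ M]

theorem isInvertible_chartFrame {p : M} {y : E} (hy : y ∈ (extChartAt 𝓘(ℝ, E) p).target) :
    (chartFrame p y).IsInvertible := by
  have : IsManifold 𝓘(ℝ, E) 1 M := .of_le (n := ∞) (by simp)
  rw [chartFrame_eq]
  exact isInvertible_mfderivWithin_extChartAt_symm hy

/-- The tangent space at `p` is the model space, identified through the preferred chart at `p`
itself. So at the base point the coordinate expression of a tensor is the tensor. -/
theorem chartFrame_self (p : M) :
    chartFrame p (extChartAt 𝓘(ℝ, E) p p) = ContinuousLinearMap.id ℝ E := by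
  have : IsManifold 𝓘(ℝ, E) 1 M := .of_le (n := ∞) (by simp)
  rw [chartFrame_eq]
  exact mfderivWithin_range_extChartAt_symm

theorem endInChart_self (a : EndField E M) (p : M) :
    endInChart a p (extChartAt 𝓘(ℝ, E) p p) = a p := by
  rw [endInChart, chartFrame_self, ContinuousLinearMap.inverse_id, extChartAt_to_inv]
  rfl

theorem bilinInChart_self (Ω : BilinField E M) (p : M) :
    bilinInChart Ω p (extChartAt 𝓘(ℝ, E) p p) = Ω p := by
  rw [bilinInChart, chartFrame_self, extChartAt_to_inv]
  rfl

theorem contMDiffAt_comp_extChartAt_iff {F : Type*} [NormedAddCommGroup F] [NormedSpace ℝ F]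
    {g : E → F} {p : M} :
    ContMDiffAt 𝓘(ℝ, E) 𝓘(ℝ, F) ∞ (fun q => g (extChartAt 𝓘(ℝ, E) p q)) p
      ↔ ContDiffAt ℝ ∞ g (extChartAt 𝓘(ℝ, E) p p) := by
  constructor
  · intro h
    have h1 : ContMDiffAt 𝓘(ℝ, E) 𝓘(ℝ, E) ∞ (extChartAt 𝓘(ℝ, E) p).symm
        (extChartAt 𝓘(ℝ, E) p p) :=
      (contMDiffOn_extChartAt_symm p).contMDiffAt (chart_target_mem_nhds p)
    have h2 := ContMDiffAt.comp (extChartAt 𝓘(ℝ, E) p p) (by rwa [extChartAt_to_inv]) h1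
    refine (h2.congr_of_eventuallyEq ?_).contDiffAt
    filter_upwards [chart_target_mem_nhds p] with y hy
    rw [comp_apply, (extChartAt 𝓘(ℝ, E) p).right_inv hy]
  · intro h
    exact ContMDiffAt.comp p h.contMDiffAt contMDiffAt_extChartAt

theorem inverse_chartFrame_apply {p q : M} (hq : q ∈ (extChartAt 𝓘(ℝ, E) p).source) :
    (chartFrame p (extChartAt 𝓘(ℝ, E) p q)).inverse
      = mfderiv 𝓘(ℝ, E) 𝓘(ℝ, E) (extChartAt 𝓘(ℝ, E) p) q := by
  have : IsManifold 𝓘(ℝ, E) 1 M := .of_le (n := ∞) (by simp)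
  apply ContinuousLinearMap.inverse_eq
  · rw [chartFrame_eq]
    exact mfderivWithin_extChartAt_symm_comp_mfderiv_extChartAt' hq
  · rw [chartFrame_eq]
    exact mfderiv_extChartAt_comp_mfderivWithin_extChartAt_symm' hq

/-- Near `p` the trivialization of the tangent bundle at `p` is the derivative of the preferred
chart, so the bundle coordinates of `a` are its conjugate by the chart frame. -/
theorem smoothEndAt_iff (a : EndField E M) (p : M) :
    ContMDiffAt 𝓘(ℝ, E) (𝓘(ℝ, E).prod 𝓘(ℝ, E →L[ℝ] E)) ∞
      (fun q => Bundle.TotalSpace.mk' (E →L[ℝ] E) (E := fun q : M => Tan E q →L[ℝ] Tan E q) q (a q))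
      p ↔ ContDiffAt ℝ ∞ (endInChart a p) (extChartAt 𝓘(ℝ, E) p p) := by
  have : IsManifold 𝓘(ℝ, E) 1 M := .of_le (n := ∞) (by simp)
  rw [contMDiffAt_hom_bundle, ← contMDiffAt_comp_extChartAt_iff]
  refine (and_iff_right contMDiffAt_id).trans (Filter.EventuallyEq.contMDiffAt_iff ?_)
  filter_upwards [extChartAt_source_mem_nhds (I := 𝓘(ℝ, E)) p] with q hq
  have hq' : q ∈ (chartAt E p).source := by rwa [← extChartAt_source 𝓘(ℝ, E)]
  rw [endInChart, inverse_chartFrame_apply hq]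
  simp only [ContinuousLinearMap.inCoordinates]
  rw [TangentBundle.continuousLinearMapAt_trivializationAt hq',
    TangentBundle.symmL_trivializationAt hq', ← chartFrame_eq, (extChartAt 𝓘(ℝ, E) p).left_inv hq]
  rfl

theorem smoothBilinAt_iff (Ω : BilinField E M) (p : M) :
    ContMDiffAt 𝓘(ℝ, E) (𝓘(ℝ, E).prod 𝓘(ℝ, E →L[ℝ] E →L[ℝ] ℝ)) ∞
    (fun q => Bundle.TotalSpace.mk' (E →L[ℝ] E →L[ℝ] ℝ)
      (E := fun q : M => Tan E q →L[ℝ] Cot E q) q (Ω q)) p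
      ↔ ContDiffAt ℝ ∞ (bilinInChart Ω p) (extChartAt 𝓘(ℝ, E) p p) := by
  have : IsManifold 𝓘(ℝ, E) 1 M := .of_le (n := ∞) (by simp)
  rw [contMDiffAt_hom_bundle, ← contMDiffAt_comp_extChartAt_iff]
  refine (and_iff_right contMDiffAt_id).trans (Filter.EventuallyEq.contMDiffAt_iff ?_)
  filter_upwards [extChartAt_source_mem_nhds (I := 𝓘(ℝ, E)) p] with q hq
  have hq' : q ∈ (chartAt E p).source := by rwa [← extChartAt_source 𝓘(ℝ, E)]
  ext v w
  rw [inCoordinates_apply_eq₂ hq' hq' (by simp)]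
  rw [bilinInChart_apply]
  have h1 : ∀ v, (trivializationAt E (TangentSpace 𝓘(ℝ, E)) p).symm q v
      = chartFrame p (extChartAt 𝓘(ℝ, E) p q) v := by
    intro v
    rw [chartFrame_eq, ← TangentBundle.symmL_trivializationAt hq']
    exact (Bundle.Trivialization.symmL_apply _ hq' _).symm
  rw [h1, h1, (extChartAt 𝓘(ℝ, E) p).left_inv hq]
  simp

theorem smoothVFieldAt_iff (X : VField E M) (p : M) : SmoothVFieldAt X p
    ↔ ContDiffAt ℝ ∞ (fun y => (chartFrame p y).inverse (X ((extChartAt 𝓘(ℝ, E) p).symm y)))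
      (extChartAt 𝓘(ℝ, E) p p) := by
  have : IsManifold 𝓘(ℝ, E) 1 M := .of_le (n := ∞) (by simp)
  rw [SmoothVFieldAt, Bundle.contMDiffAt_section, ← contMDiffAt_comp_extChartAt_iff]
  refine Filter.EventuallyEq.contMDiffAt_iff ?_
  filter_upwards [extChartAt_source_mem_nhds (I := 𝓘(ℝ, E)) p] with q hq
  have hq' : q ∈ (chartAt E p).source := by rwa [← extChartAt_source 𝓘(ℝ, E)]
  rw [inverse_chartFrame_apply hq, ← TangentBundle.continuousLinearMapAt_trivializationAt hq',
    (extChartAt 𝓘(ℝ, E) p).left_inv hq]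
  exact (Bundle.Trivialization.continuousLinearMapAt_apply_of_mem (R := ℝ) _ hq' _).symm

/-- Torsion and closedness are tested on fields smooth at a single point, so a local extension of
`v` suffices to pass from fields to vectors, without any cut-off function. -/
theorem exists_smoothVFieldAt (p : M) (v : E) : ∃ X : VField E M, SmoothVFieldAt X p ∧ X p = v :=
  ⟨FiberBundle.extend E (E := fun q : M => Tan E q) (x := p) v,
    FiberBundle.contMDiffAt_extend 𝓘(ℝ, E) E (V := fun q : M => Tan E q) (x := p) v,
    FiberBundle.extend_apply_self E (E := fun q : M => Tan E q) (x := p) v⟩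

omit [IsManifold 𝓘(ℝ, E) ∞ M] in
theorem vfieldInChart_apply (X : VField E M) (p : M) (y : E) : vfieldInChart X p y
    = (chartFrame p y).inverse (X ((extChartAt 𝓘(ℝ, E) p).symm y)) := rfl

theorem chartFrame_vfieldInChart (X : VField E M) {p : M} {y : E}
    (hy : y ∈ (extChartAt 𝓘(ℝ, E) p).target) :
    chartFrame p y (vfieldInChart X p y) = X ((extChartAt 𝓘(ℝ, E) p).symm y) :=
  (isInvertible_chartFrame hy).self_apply_inverse _

theorem chartFrame_endInChart (a : EndField E M) {p : M} {y : E}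
    (hy : y ∈ (extChartAt 𝓘(ℝ, E) p).target) (v : E) :
    chartFrame p y (endInChart a p y v)
      = a ((extChartAt 𝓘(ℝ, E) p).symm y) (chartFrame p y v) :=
  (isInvertible_chartFrame hy).self_apply_inverse _

theorem vfieldInChart_self (X : VField E M) (p : M) :
    vfieldInChart X p (extChartAt 𝓘(ℝ, E) p p) = X p := by
  rw [vfieldInChart_apply, chartFrame_self, ContinuousLinearMap.inverse_id, extChartAt_to_inv]
  rfl

theorem SmoothVFieldAt.differentiableAt {X : VField E M} {p : M} (hX : SmoothVFieldAt X p) :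
    DifferentiableAt ℝ (vfieldInChart X p) (extChartAt 𝓘(ℝ, E) p p) :=
  ((smoothVFieldAt_iff X p).1 hX).differentiableAt (by simp)

theorem SmoothEnd.differentiableAt {a : EndField E M} (ha : SmoothEnd a) (p : M) :
    DifferentiableAt ℝ (endInChart a p) (extChartAt 𝓘(ℝ, E) p p) :=
  ((smoothEndAt_iff a p).1 (ha p)).differentiableAt (by simp)

theorem SmoothBilin.differentiableAt {Ω : BilinField E M} (h : SmoothBilin Ω) (p : M) :
    DifferentiableAt ℝ (bilinInChart Ω p) (extChartAt 𝓘(ℝ, E) p p) :=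
  ((smoothBilinAt_iff Ω p).1 (h p)).differentiableAt (by simp)

theorem bracket_eq (X Y : VField E M) (p : M) : bracket X Y p
    = fderiv ℝ (vfieldInChart Y p) (extChartAt 𝓘(ℝ, E) p p) (X p)
      - fderiv ℝ (vfieldInChart X p) (extChartAt 𝓘(ℝ, E) p p) (Y p) := by
  have : IsManifold 𝓘(ℝ, E) 1 M := .of_le (n := ∞) (by simp)
  have hi : (mfderiv 𝓘(ℝ, E) 𝓘(ℝ, E) (extChartAt 𝓘(ℝ, E) p) p).inverse
      = ContinuousLinearMap.id ℝ E := by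
    rw [mfderiv_extChartAt_self]
    exact ContinuousLinearMap.inverse_id
  have h : bracket X Y p
      = (mfderiv 𝓘(ℝ, E) 𝓘(ℝ, E) (extChartAt 𝓘(ℝ, E) p) p).inverse
        (lieBracketWithin ℝ (E := E) (vfieldInChart X p) (vfieldInChart Y p) univ
          (extChartAt 𝓘(ℝ, E) p p)) := by
    rw [bracket, ← mlieBracketWithin_univ, mlieBracketWithin_apply]
    simp only [modelWithCornersSelf_coe, range_id, preimage_univ, univ_inter,
      mpullbackWithin_univ]
    rfl
  have h2 : lieBracketWithin ℝ (E := E) (vfieldInChart X p) (vfieldInChart Y p) univ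
      (extChartAt 𝓘(ℝ, E) p p) = fderiv ℝ (vfieldInChart Y p) (extChartAt 𝓘(ℝ, E) p p) (X p)
      - fderiv ℝ (vfieldInChart X p) (extChartAt 𝓘(ℝ, E) p p) (Y p) := by
    rw [lieBracketWithin_univ, lieBracket, vfieldInChart_self, vfieldInChart_self]
  rw [h, hi]
  exact h2

theorem vfieldInChart_end (a : EndField E M) (X : VField E M) (p : M) :
    vfieldInChart (fun q => a q (X q)) p =ᶠ[𝓝 (extChartAt 𝓘(ℝ, E) p p)]
      fun y => endInChart a p y (vfieldInChart X p y) := by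
  filter_upwards [chart_target_mem_nhds p] with y hy
  rw [vfieldInChart_apply, ← chartFrame_vfieldInChart X hy]
  rfl

/-- Tensoriality of the torsion: after the product rule the derivatives of `X` and `Y` cancel, which
is the content of `core`. -/
theorem torsion_eq {a : EndField E M} (ha : SmoothEnd a) {X Y : VField E M} {p : M}
    (hX : SmoothVFieldAt X p) (hY : SmoothVFieldAt Y p) :
    torsion a X Y p
      = flatTorsion (endInChart a p) (extChartAt 𝓘(ℝ, E) p p) (X p) (Y p) := by
  have hA := ha.differentiableAt p
  have hd : ∀ {Z : VField E M}, SmoothVFieldAt Z p → ∀ w : E,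
      fderiv ℝ (vfieldInChart (fun q => a q (Z q)) p) (extChartAt 𝓘(ℝ, E) p p) w
        = fderiv ℝ (endInChart a p) (extChartAt 𝓘(ℝ, E) p p) w (Z p)
          + (show E →L[ℝ] E from a p)
            (fderiv ℝ (vfieldInChart Z p) (extChartAt 𝓘(ℝ, E) p p) w) := by
    intro Z hZ w
    rw [(vfieldInChart_end a Z p).fderiv_eq,
      (hA.hasFDerivAt.clm_apply hZ.differentiableAt.hasFDerivAt).fderiv]
    simp only [_root_.add_apply, vfieldInChart_self, endInChart_self]
    exact add_comm _ _
  have h1 := bracket_eq (fun q => a q (X q)) (fun q => a q (Y q)) p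
  have h2 := bracket_eq (fun q => a q (X q)) Y p
  have h3 := bracket_eq X (fun q => a q (Y q)) p
  have h4 := bracket_eq X Y p
  erw [hd hX, hd hY] at h1
  erw [hd hX] at h2
  erw [hd hY] at h3
  have core : ∀ (A DX DY : E →L[ℝ] E) (DA : E →L[ℝ] E →L[ℝ] E) (u v : E),
      (DA (A u) v + A (DY (A u)) - (DA (A v) u + A (DX (A v)))) + A (A (DY u - DX v))
        - A ((DY (A u) - (DA v u + A (DX v))) + ((DA u v + A (DY u)) - DX (A v)))
      = DA (A u) v - DA (A v) u - A (DA u v) + A (DA v u) := by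
    intro A DX DY DA u v
    simp only [map_add, map_sub]
    abel
  have e : ∀ u v : E, flatTorsion (endInChart a p) (extChartAt 𝓘(ℝ, E) p p) u v
      = fderiv ℝ (endInChart a p) (extChartAt 𝓘(ℝ, E) p p) ((show E →L[ℝ] E from a p) u) v
        - fderiv ℝ (endInChart a p) (extChartAt 𝓘(ℝ, E) p p) ((show E →L[ℝ] E from a p) v) u
        - (show E →L[ℝ] E from a p)
          (fderiv ℝ (endInChart a p) (extChartAt 𝓘(ℝ, E) p p) u v)
        + (show E →L[ℝ] E from a p)
          (fderiv ℝ (endInChart a p) (extChartAt 𝓘(ℝ, E) p p) v u) := by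
    intro u v
    rw [flatTorsion, endInChart_self]
  rw [torsion, h1, h2, h3, h4]
  exact (core _ _ _ _ _ _).trans (e _ _).symm

theorem deriveAlong_eq {Ω : BilinField E M} (hΩ : SmoothBilin Ω) {X Y Z : VField E M} {p : M}
    (hY : SmoothVFieldAt Y p) (hZ : SmoothVFieldAt Z p) :
    deriveAlong X (fun q => Ω q (Y q) (Z q)) p
      = (fderiv ℝ (bilinInChart Ω p) (extChartAt 𝓘(ℝ, E) p p) (X p) (Y p) (Z p) : ℝ)
        + Ω p (fderiv ℝ (vfieldInChart Y p) (extChartAt 𝓘(ℝ, E) p p) (X p)) (Z p)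
        + Ω p (Y p) (fderiv ℝ (vfieldInChart Z p) (extChartAt 𝓘(ℝ, E) p p) (X p)) := by
  have hη := hΩ.differentiableAt p
  have hd := hη.clm_apply hY.differentiableAt |>.clm_apply hZ.differentiableAt
  have he : (fun q => Ω q (Y q) (Z q)) =ᶠ[𝓝 p]
      (fun y => bilinInChart Ω p y (vfieldInChart Y p y) (vfieldInChart Z p y))
        ∘ extChartAt 𝓘(ℝ, E) p := by
    filter_upwards [extChartAt_source_mem_nhds (I := 𝓘(ℝ, E)) p] with q hq
    have hy := (extChartAt 𝓘(ℝ, E) p).map_source hq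
    rw [comp_apply, bilinInChart_apply, chartFrame_vfieldInChart Y hy,
      chartFrame_vfieldInChart Z hy, (extChartAt 𝓘(ℝ, E) p).left_inv hq]
  have hc : MDifferentiableAt 𝓘(ℝ, E) 𝓘(ℝ, E) (extChartAt 𝓘(ℝ, E) p) p := by
    have : IsManifold 𝓘(ℝ, E) 1 M := .of_le (n := ∞) (by simp)
    exact mdifferentiableAt_extChartAt (mem_chart_source E p)
  have h1 : deriveAlong X (fun q => Ω q (Y q) (Z q)) p
      = fderiv ℝ (fun y => bilinInChart Ω p y (vfieldInChart Y p y) (vfieldInChart Z p y))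
        (extChartAt 𝓘(ℝ, E) p p) (X p) := by
    have : IsManifold 𝓘(ℝ, E) 1 M := .of_le (n := ∞) (by simp)
    have h2 := mfderiv_comp p hd.mdifferentiableAt hc
    rw [mfderiv_extChartAt_self, mfderiv_eq_fderiv] at h2
    have h3 := he.mfderiv_eq (I := 𝓘(ℝ, E)) (I' := 𝓘(ℝ, ℝ))
    rw [h2] at h3
    exact congrArg (fun T : E →L[ℝ] ℝ => T (X p)) h3
  rw [h1]
  refine (hasFDerivAt_bilin_apply hη hY.differentiableAt hZ.differentiableAt _).trans ?_
  rw [vfieldInChart_self, vfieldInChart_self, bilinInChart_self]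
  rfl

/-- Skewness makes the derivatives of the three fields cancel against the bracket terms, so the
Koszul formula only sees the values of the fields at `p`. -/
theorem koszul_eq {Ω : BilinField E M} (hΩ : SmoothBilin Ω) {X Y Z : VField E M} {p : M}
    (hskew : ∀ v w : Tan E p, Ω p v w = - Ω p w v)
    (hX : SmoothVFieldAt X p) (hY : SmoothVFieldAt Y p) (hZ : SmoothVFieldAt Z p) :
    deriveAlong X (fun q => Ω q (Y q) (Z q)) p + deriveAlong Y (fun q => Ω q (Z q) (X q)) p
      + deriveAlong Z (fun q => Ω q (X q) (Y q)) p
      - Ω p (bracket X Y p) (Z p) - Ω p (bracket Z X p) (Y p) - Ω p (bracket Y Z p) (X p)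
      = flatExtDeriv (bilinInChart Ω p) (extChartAt 𝓘(ℝ, E) p p) (X p) (Y p) (Z p) := by
  have core : ∀ (B : E →L[ℝ] E →L[ℝ] ℝ) (_ : ∀ v w, B v w = - B w v) (DX DY DZ : E →L[ℝ] E)
      (D : E →L[ℝ] E →L[ℝ] E →L[ℝ] ℝ) (u v w : E),
      (D u v w + B (DY u) w + B v (DZ u)) + (D v w u + B (DZ v) u + B w (DX v))
        + (D w u v + B (DX w) v + B u (DY w))
        - B (DY u - DX v) w - B (DX w - DZ u) v - B (DZ v - DY w) u
      = D u v w + D v w u + D w u v := by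
    intro B hB DX DY DZ D u v w
    simp only [map_sub, _root_.sub_apply]
    rw [hB v (DZ u), hB w (DX v), hB u (DY w)]
    ring
  rw [deriveAlong_eq hΩ hY hZ, deriveAlong_eq hΩ hZ hX, deriveAlong_eq hΩ hX hY,
    bracket_eq X Y, bracket_eq Z X, bracket_eq Y Z]
  exact core (Ω p) hskew _ _ _ _ _ _ _

theorem isClosedForm_iff {Ω : BilinField E M} (hΩ : SmoothBilin Ω)
    (hskew : ∀ (p : M) (v w : Tan E p), Ω p v w = - Ω p w v) :
    IsClosedForm Ω ↔ ∀ (p : M) (u v w : E),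
      flatExtDeriv (bilinInChart Ω p) (extChartAt 𝓘(ℝ, E) p p) u v w = 0 := by
  constructor
  · intro h p u v w
    obtain ⟨X, hX, rfl⟩ := exists_smoothVFieldAt p u
    obtain ⟨Y, hY, rfl⟩ := exists_smoothVFieldAt p v
    obtain ⟨Z, hZ, rfl⟩ := exists_smoothVFieldAt p w
    rw [← koszul_eq hΩ (hskew p) hX hY hZ]
    exact h p X Y Z hX hY hZ
  · intro h p X Y Z hX hY hZ
    rw [koszul_eq hΩ (hskew p) hX hY hZ]
    exact h p _ _ _

end Charts

/-- The torsion tensor of a smooth `(1,1)`-tensor at a point. -/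
def torsionAt {E : Type*} [NormedAddCommGroup E] [NormedSpace ℝ E]
    {M : Type*} [TopologicalSpace M] [ChartedSpace E M] (a : EndField E M) (p : M) (u v : E) : E :=
  flatTorsion (endInChart a p) (extChartAt 𝓘(ℝ, E) p p) u v

/-- The exterior derivative of a smooth two-form at a point. -/
def extDerivAt {E : Type*} [NormedAddCommGroup E] [NormedSpace ℝ E]
    {M : Type*} [TopologicalSpace M] [ChartedSpace E M] (Ω : BilinField E M) (p : M)
    (u v w : E) : ℝ :=
  flatExtDeriv (bilinInChart Ω p) (extChartAt 𝓘(ℝ, E) p p) u v w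

/-! ### Naturality of torsion and exterior derivative under smooth maps. -/

section MapsInCharts

variable {E₁ : Type*} [NormedAddCommGroup E₁] [NormedSpace ℝ E₁]
variable {M₁ : Type*} [TopologicalSpace M₁] [ChartedSpace E₁ M₁]
variable {E₂ : Type*} [NormedAddCommGroup E₂] [NormedSpace ℝ E₂]
variable {M₂ : Type*} [TopologicalSpace M₂] [ChartedSpace E₂ M₂]

variable (E₁ E₂) in
/-- The expression of a map in the preferred charts at `p` and `f p`. -/
def mapInChart (f : M₁ → M₂) (p : M₁) (y : E₁) : E₂ :=
  extChartAt 𝓘(ℝ, E₂) (f p) (f ((extChartAt 𝓘(ℝ, E₁) p).symm y))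

theorem mapInChart_self (f : M₁ → M₂) (p : M₁) :
    mapInChart E₁ E₂ f p (extChartAt 𝓘(ℝ, E₁) p p) = extChartAt 𝓘(ℝ, E₂) (f p) (f p) := by
  rw [mapInChart, extChartAt_to_inv]

theorem contDiffAt_mapInChart {f : M₁ → M₂} {p : M₁}
    (hf : ContMDiffAt 𝓘(ℝ, E₁) 𝓘(ℝ, E₂) ∞ f p) :
    ContDiffAt ℝ ∞ (mapInChart E₁ E₂ f p) (extChartAt 𝓘(ℝ, E₁) p p) := by
  have h := (contMDiffAt_iff.1 hf).2
  rw [modelWithCornersSelf_coe, range_id, contDiffWithinAt_univ] at h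
  exact h

theorem contDiffAt_two_mapInChart {f : M₁ → M₂} {p : M₁}
    (hf : ContMDiffAt 𝓘(ℝ, E₁) 𝓘(ℝ, E₂) ∞ f p) :
    ContDiffAt ℝ 2 (mapInChart E₁ E₂ f p) (extChartAt 𝓘(ℝ, E₁) p p) := by
  exact_mod_cast contDiffAt_infty.1 (contDiffAt_mapInChart hf) 2

theorem fderiv_mapInChart_self {f : M₁ → M₂} {p : M₁}
    (hf : ContMDiffAt 𝓘(ℝ, E₁) 𝓘(ℝ, E₂) ∞ f p) :
    fderiv ℝ (mapInChart E₁ E₂ f p) (extChartAt 𝓘(ℝ, E₁) p p) = dmap E₁ E₂ f p := by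
  have h := (hf.mdifferentiableAt (by simp)).mfderiv
  rw [modelWithCornersSelf_coe, range_id, fderivWithin_univ] at h
  exact h.symm

variable [IsManifold 𝓘(ℝ, E₁) ∞ M₁] [IsManifold 𝓘(ℝ, E₂) ∞ M₂]

omit [IsManifold 𝓘(ℝ, E₁) ∞ M₁] [IsManifold 𝓘(ℝ, E₂) ∞ M₂] in
theorem eventually_mem_source {f : M₁ → M₂} {p : M₁} (hf : ContinuousAt f p) :
    ∀ᶠ y in 𝓝 (extChartAt 𝓘(ℝ, E₁) p p), y ∈ (extChartAt 𝓘(ℝ, E₁) p).target ∧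
      f ((extChartAt 𝓘(ℝ, E₁) p).symm y) ∈ (extChartAt 𝓘(ℝ, E₂) (f p)).source := by
  refine Filter.Eventually.and (chart_target_mem_nhds p) ?_
  have h1 := continuousAt_extChartAt_symm (I := 𝓘(ℝ, E₁)) p
  have h2 : ContinuousAt f ((extChartAt 𝓘(ℝ, E₁) p).symm (extChartAt 𝓘(ℝ, E₁) p p)) := by
    rwa [extChartAt_to_inv]
  have h3 := ContinuousAt.comp h2 h1
  refine h3.eventually_mem ?_
  simp only [comp_apply, extChartAt_to_inv]
  exact extChartAt_source_mem_nhds (I := 𝓘(ℝ, E₂)) (f p)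

/-- Chain rule for `chart⁻¹ ∘ (f in charts) = f ∘ chart⁻¹`. It is needed on a whole neighbourhood of
the base point, because naturality is proved by differentiating relations between tensors. -/
theorem eventually_chartFrame_fderiv {f : M₁ → M₂} {p : M₁}
    (hf : ContMDiff 𝓘(ℝ, E₁) 𝓘(ℝ, E₂) ∞ f) :
    ∀ᶠ y in 𝓝 (extChartAt 𝓘(ℝ, E₁) p p), ∀ v,
      chartFrame (f p) (mapInChart E₁ E₂ f p y) (fderiv ℝ (mapInChart E₁ E₂ f p) y v)
        = dmap E₁ E₂ f ((extChartAt 𝓘(ℝ, E₁) p).symm y) (chartFrame p y v) := by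
  have m1 : IsManifold 𝓘(ℝ, E₁) 1 M₁ := .of_le (n := ∞) (by simp)
  have m2 : IsManifold 𝓘(ℝ, E₂) 1 M₂ := .of_le (n := ∞) (by simp)
  have hev := eventually_mem_source (E₁ := E₁) (E₂ := E₂) (hf.continuous.continuousAt (x := p))
  filter_upwards [hev.eventually_nhds] with y hy v
  obtain ⟨hy1, hy2⟩ := hy.self_of_nhds
  have hs1 : MDifferentiableAt 𝓘(ℝ, E₁) 𝓘(ℝ, E₁) (extChartAt 𝓘(ℝ, E₁) p).symm y :=
    ((contMDiffOn_extChartAt_symm (n := 1) p).contMDiffAt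
      ((isOpen_extChartAt_target p).mem_nhds hy1)).mdifferentiableAt (by simp)
  have hff : MDifferentiableAt 𝓘(ℝ, E₁) 𝓘(ℝ, E₂) f ((extChartAt 𝓘(ℝ, E₁) p).symm y) :=
    (hf _).mdifferentiableAt (by simp)
  have hs2 : MDifferentiableAt 𝓘(ℝ, E₂) 𝓘(ℝ, E₂) (extChartAt 𝓘(ℝ, E₂) (f p)).symm
      (mapInChart E₁ E₂ f p y) :=
    ((contMDiffOn_extChartAt_symm (n := 1) (f p)).contMDiffAt
      ((isOpen_extChartAt_target (f p)).mem_nhds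
        ((extChartAt 𝓘(ℝ, E₂) (f p)).map_source hy2))).mdifferentiableAt (by simp)
  have hs3 : MDifferentiableAt 𝓘(ℝ, E₂) 𝓘(ℝ, E₂) (extChartAt 𝓘(ℝ, E₂) (f p))
      (f ((extChartAt 𝓘(ℝ, E₁) p).symm y)) :=
    mdifferentiableAt_extChartAt (by rwa [← extChartAt_source 𝓘(ℝ, E₂)])
  have hF : MDifferentiableAt 𝓘(ℝ, E₁) 𝓘(ℝ, E₂) (mapInChart E₁ E₂ f p) y :=
    hs3.comp y (hff.comp y hs1)
  have he : (extChartAt 𝓘(ℝ, E₂) (f p)).symm ∘ mapInChart E₁ E₂ f p =ᶠ[𝓝 y]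
      f ∘ (extChartAt 𝓘(ℝ, E₁) p).symm := by
    filter_upwards [hy] with z hz
    exact (extChartAt 𝓘(ℝ, E₂) (f p)).left_inv hz.2
  have h1 := he.mfderiv_eq (I := 𝓘(ℝ, E₁)) (I' := 𝓘(ℝ, E₂))
  have h2 := mfderiv_comp y hs2 hF
  have h3 := mfderiv_comp y hff hs1
  rw [h2, h3, mfderiv_eq_fderiv] at h1
  exact congrArg (fun T : E₁ →L[ℝ] E₂ => T v) h1

theorem intertwines_inChart {f : M₁ → M₂} (hf : ContMDiff 𝓘(ℝ, E₁) 𝓘(ℝ, E₂) ∞ f)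
    {a₁ : EndField E₁ M₁} {a₂ : EndField E₂ M₂} (h : Intertwines a₁ a₂ f) (p : M₁) :
    ∀ᶠ y in 𝓝 (extChartAt 𝓘(ℝ, E₁) p p), ∀ v,
      fderiv ℝ (mapInChart E₁ E₂ f p) y (endInChart a₁ p y v)
        = endInChart a₂ (f p) (mapInChart E₁ E₂ f p y) (fderiv ℝ (mapInChart E₁ E₂ f p) y v) := by
  filter_upwards [eventually_mem_source (E₁ := E₁) (E₂ := E₂) (hf.continuous.continuousAt (x := p)),
    eventually_chartFrame_fderiv hf (p := p)] with y hy hd v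
  have ht : mapInChart E₁ E₂ f p y ∈ (extChartAt 𝓘(ℝ, E₂) (f p)).target :=
    (extChartAt 𝓘(ℝ, E₂) (f p)).map_source hy.2
  apply (isInvertible_chartFrame ht).injective
  rw [hd, chartFrame_endInChart a₁ hy.1, chartFrame_endInChart a₂ ht, hd]
  -- The two base points agree only after cancelling the chart with its inverse, so the
  -- endomorphisms are compared as maps of the model space.
  have h1 : (show E₂ →L[ℝ] E₂ from
      a₂ ((extChartAt 𝓘(ℝ, E₂) (f p)).symm (mapInChart E₁ E₂ f p y)))
      = a₂ (f ((extChartAt 𝓘(ℝ, E₁) p).symm y)) := by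
    rw [mapInChart, (extChartAt 𝓘(ℝ, E₂) (f p)).left_inv hy.2]
  exact (h _ _).trans (congrArg (fun T : E₂ →L[ℝ] E₂ => T _) h1.symm)

theorem pullForm_inChart {f : M₁ → M₂} (hf : ContMDiff 𝓘(ℝ, E₁) 𝓘(ℝ, E₂) ∞ f)
    {Ω₁ : BilinField E₁ M₁} {Ω₂ : BilinField E₂ M₂}
    (h : ∀ (p : M₁) (v w : Tan E₁ p), pullForm f Ω₂ p v w = Ω₁ p v w) (p : M₁) :
    ∀ᶠ y in 𝓝 (extChartAt 𝓘(ℝ, E₁) p p), ∀ v w,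
      bilinInChart Ω₁ p y v w
        = bilinInChart Ω₂ (f p) (mapInChart E₁ E₂ f p y) (fderiv ℝ (mapInChart E₁ E₂ f p) y v)
          (fderiv ℝ (mapInChart E₁ E₂ f p) y w) := by
  filter_upwards [eventually_mem_source (E₁ := E₁) (E₂ := E₂) (hf.continuous.continuousAt (x := p)),
    eventually_chartFrame_fderiv hf (p := p)] with y hy hd v w
  rw [bilinInChart_apply, bilinInChart_apply, hd, hd]
  refine (h _ _ _).symm.trans ?_
  have h1 : (show E₂ →L[ℝ] E₂ →L[ℝ] ℝ from
      Ω₂ ((extChartAt 𝓘(ℝ, E₂) (f p)).symm (mapInChart E₁ E₂ f p y)))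
      = Ω₂ (f ((extChartAt 𝓘(ℝ, E₁) p).symm y)) := by
    rw [mapInChart, (extChartAt 𝓘(ℝ, E₂) (f p)).left_inv hy.2]
  exact (congrArg (fun T : E₂ →L[ℝ] E₂ →L[ℝ] ℝ => T _ _) h1.symm)

theorem torsionAt_of_intertwines {f : M₁ → M₂} (hf : ContMDiff 𝓘(ℝ, E₁) 𝓘(ℝ, E₂) ∞ f)
    {a₁ : EndField E₁ M₁} {a₂ : EndField E₂ M₂} (h₁ : SmoothEnd a₁) (h₂ : SmoothEnd a₂)
    (h : Intertwines a₁ a₂ f) (p : M₁) (u v : E₁) :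
    dmap E₁ E₂ f p (torsionAt (E := E₁) a₁ p u v)
      = torsionAt (E := E₂) a₂ (f p) (dmap E₁ E₂ f p u) (dmap E₁ E₂ f p v) := by
  have h2 := h₂.differentiableAt (f p)
  rw [← mapInChart_self (E₁ := E₁) (E₂ := E₂) f p] at h2
  have := flatTorsion_of_intertwines (contDiffAt_two_mapInChart (hf p))
    (h₁.differentiableAt p) h2 (intertwines_inChart hf h p) u v
  rw [fderiv_mapInChart_self (hf p), mapInChart_self] at this
  exact this

theorem extDerivAt_pullForm {f : M₁ → M₂} (hf : ContMDiff 𝓘(ℝ, E₁) 𝓘(ℝ, E₂) ∞ f)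
    {Ω₁ : BilinField E₁ M₁} {Ω₂ : BilinField E₂ M₂} (h₁ : SmoothBilin Ω₁) (h₂ : SmoothBilin Ω₂)
    (h : ∀ (p : M₁) (v w : Tan E₁ p), pullForm f Ω₂ p v w = Ω₁ p v w) (p : M₁)
    (hskew : ∀ v w : Tan E₂ (f p), Ω₂ (f p) v w = - Ω₂ (f p) w v) (u v w : E₁) :
    extDerivAt Ω₁ p u v w
      = extDerivAt (E := E₂) Ω₂ (f p) (dmap E₁ E₂ f p u) (dmap E₁ E₂ f p v) (dmap E₁ E₂ f p w) := by
  have h2 := h₂.differentiableAt (f p)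
  rw [← mapInChart_self (E₁ := E₁) (E₂ := E₂) f p] at h2
  have := flatExtDeriv_pullback (contDiffAt_two_mapInChart (hf p))
    (h₁.differentiableAt p) h2
    (by rw [mapInChart_self, bilinInChart_self]; exact hskew) (pullForm_inChart hf h p) u v w
  rw [fderiv_mapInChart_self (hf p), mapInChart_self] at this
  exact this

end MapsInCharts

/-! ### Local inverses of immersions and submersions. -/

section Local

universe u v
variable {E₁ : Type u} [NormedAddCommGroup E₁] [NormedSpace ℝ E₁]
variable {M₁ : Type*} [TopologicalSpace M₁] [ChartedSpace E₁ M₁]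
variable {E₂ : Type v} [NormedAddCommGroup E₂] [NormedSpace ℝ E₂]
variable {M₂ : Type*} [TopologicalSpace M₂] [ChartedSpace E₂ M₂]
variable [IsManifold 𝓘(ℝ, E₁) ∞ M₁] [IsManifold 𝓘(ℝ, E₂) ∞ M₂]

omit [IsManifold 𝓘(ℝ, E₁) ∞ M₁] [IsManifold 𝓘(ℝ, E₂) ∞ M₂] in
-- In adapted charts an immersion is `u ↦ (u, 0)`; the left inverse is the first projection.
theorem exists_local_left_inverse {f : M₁ → M₂} {p : M₁}
    (hf : IsImmersionAt 𝓘(ℝ, E₁) 𝓘(ℝ, E₂) ∞ f p) :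
    ∃ r : M₂ → M₁, ContMDiffAt 𝓘(ℝ, E₂) 𝓘(ℝ, E₁) ∞ r (f p) ∧ ∀ᶠ q in 𝓝 p, r (f q) = q := by
  let φ := hf.domChart.extend 𝓘(ℝ, E₁)
  let ψ := hf.codChart.extend 𝓘(ℝ, E₂)
  let L : E₂ →L[ℝ] E₁ := (ContinuousLinearMap.fst ℝ E₁ hf.complement).comp
    (hf.equiv.symm : E₂ →L[ℝ] E₁ × hf.complement)
  have key : ∀ q ∈ hf.domChart.source, L (ψ (f q)) = φ q := by
    intro q hq
    have hs : q ∈ φ.source := by rwa [OpenPartialHomeomorph.extend_source]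
    have hq' : φ q ∈ φ.target := φ.map_source hs
    have h1 := hf.writtenInCharts hq'
    have h2 : φ.symm (φ q) = q := φ.left_inv hs
    simp only [comp_apply] at h1
    rw [h2] at h1
    simp only [L, ψ, ContinuousLinearMap.comp_apply]
    erw [h1]
    simp
  refine ⟨fun s => φ.symm (L (ψ s)), ?_, ?_⟩
  · have h1 : ContMDiffAt 𝓘(ℝ, E₂) 𝓘(ℝ, E₂) ∞ ψ (f p) :=
      OpenPartialHomeomorph.contMDiffAt_extend hf.codChart_mem_maximalAtlas hf.mem_codChart_source
    have h2 : ContMDiffAt 𝓘(ℝ, E₂) 𝓘(ℝ, E₁) ∞ (fun s => L (ψ s)) (f p) :=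
      ContMDiffAt.comp (f p) L.contMDiff.contMDiffAt h1
    have h3 : ContMDiffAt 𝓘(ℝ, E₁) 𝓘(ℝ, E₁) ∞ φ.symm (L (ψ (f p))) := by
      rw [key p hf.mem_domChart_source]
      refine (contMDiffOn_extend_symm hf.domChart_mem_maximalAtlas).contMDiffAt ?_
      rw [modelWithCornersSelf_coe, image_id]
      exact hf.domChart.open_target.mem_nhds (hf.domChart.map_source hf.mem_domChart_source)
    exact ContMDiffAt.comp (f p) h3 h2
  · filter_upwards [hf.domChart.open_source.mem_nhds hf.mem_domChart_source] with q hq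
    rw [key q hq]
    exact φ.left_inv (by rwa [OpenPartialHomeomorph.extend_source])

omit [IsManifold 𝓘(ℝ, E₁) ∞ M₁] [IsManifold 𝓘(ℝ, E₂) ∞ M₂] in
-- In adapted charts a submersion is `(z, w) ↦ z`; the section keeps `w` at its value for `p`, so
-- that it passes through `p`.
theorem exists_local_section {f : M₁ → M₂} {p : M₁}
    (hf : IsSubmersionAt 𝓘(ℝ, E₁) 𝓘(ℝ, E₂) ∞ f p) :
    ∃ s : M₂ → M₁, ContMDiffAt 𝓘(ℝ, E₂) 𝓘(ℝ, E₁) ∞ s (f p) ∧ s (f p) = p ∧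
      ∀ᶠ q in 𝓝 (f p), f (s q) = q := by
  let φ := hf.domChart.extend 𝓘(ℝ, E₁)
  let ψ := hf.codChart.extend 𝓘(ℝ, E₂)
  let L : E₂ → E₁ := fun z => hf.equiv.symm (z, (hf.equiv (φ p)).2)
  have hp : p ∈ φ.source := by
    rw [OpenPartialHomeomorph.extend_source]
    exact hf.mem_domChart_source
  have hL : ContMDiff 𝓘(ℝ, E₂) 𝓘(ℝ, E₁) ∞ L := by
    rw [contMDiff_iff_contDiff]
    exact hf.equiv.symm.contDiff.comp (contDiff_id.prodMk contDiff_const)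
  have h0 : φ.target ∈ 𝓝 (φ p) :=
    (OpenPartialHomeomorph.isOpen_extend_target _).mem_nhds (φ.map_source hp)
  have hLp : L (ψ (f p)) = φ p := by
    have h1 := hf.writtenInCharts (φ.map_source hp)
    have h2 : φ.symm (φ p) = p := φ.left_inv hp
    simp only [comp_apply] at h1
    rw [h2] at h1
    simp only [L, ψ]
    erw [h1]
    simp [φ]
  have h1 : ContMDiffAt 𝓘(ℝ, E₂) 𝓘(ℝ, E₂) ∞ ψ (f p) :=
    OpenPartialHomeomorph.contMDiffAt_extend hf.codChart_mem_maximalAtlas hf.mem_codChart_source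
  have h2 : ContMDiffAt 𝓘(ℝ, E₂) 𝓘(ℝ, E₁) ∞ (fun s => L (ψ s)) (f p) :=
    ContMDiffAt.comp (I' := 𝓘(ℝ, E₂)) (g := L) (f p) (hL _) h1
  refine ⟨fun z => φ.symm (L (ψ z)), ?_, ?_, ?_⟩
  · have h3 : ContMDiffAt 𝓘(ℝ, E₁) 𝓘(ℝ, E₁) ∞ φ.symm (L (ψ (f p))) := by
      rw [hLp]
      refine (contMDiffOn_extend_symm hf.domChart_mem_maximalAtlas).contMDiffAt ?_
      rw [modelWithCornersSelf_coe, image_id]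
      exact hf.domChart.open_target.mem_nhds (hf.domChart.map_source hf.mem_domChart_source)
    exact ContMDiffAt.comp (f p) h3 h2
  · simp only [hLp]
    exact φ.left_inv hp
  · have h4 : ∀ᶠ z in 𝓝 (f p), L (ψ z) ∈ φ.target :=
      h2.continuousAt.eventually_mem (by rwa [hLp])
    filter_upwards [h4, hf.codChart.open_source.mem_nhds hf.mem_codChart_source] with z hz hz'
    have h5 := hf.writtenInCharts hz
    have h6 : φ.symm (L (ψ z)) ∈ hf.domChart.source := by
      rw [← OpenPartialHomeomorph.extend_source (I := 𝓘(ℝ, E₁))]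
      exact φ.map_target hz
    have h7 := hf.source_subset_preimage_source h6
    have h8 : ψ (f (φ.symm (L (ψ z)))) = ψ z := by
      refine h5.trans ?_
      simp [L]
    refine ψ.injOn ?_ ?_ h8
    · rw [OpenPartialHomeomorph.extend_source]
      exact h7
    · rw [OpenPartialHomeomorph.extend_source]
      exact hz'

end Local

/-! ### Sections and left inverses in the preferred charts. -/

section ChartSections

universe u v
variable {E₁ : Type u} [NormedAddCommGroup E₁] [NormedSpace ℝ E₁]
variable {M₁ : Type*} [TopologicalSpace M₁] [ChartedSpace E₁ M₁]
variable {E₂ : Type v} [NormedAddCommGroup E₂] [NormedSpace ℝ E₂]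
variable {M₂ : Type*} [TopologicalSpace M₂] [ChartedSpace E₂ M₂]

theorem contDiffAt_inCharts {g : M₂ → M₁} {x : M₂} {y : M₁} (hxy : g x = y)
    (hg : ContMDiffAt 𝓘(ℝ, E₂) 𝓘(ℝ, E₁) ∞ g x) :
    ContDiffAt ℝ ∞ (fun z => extChartAt 𝓘(ℝ, E₁) y (g ((extChartAt 𝓘(ℝ, E₂) x).symm z)))
      (extChartAt 𝓘(ℝ, E₂) x x) := by
  subst hxy
  exact contDiffAt_mapInChart hg

theorem exists_chart_section {f : M₁ → M₂} {p : M₁}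
    (hf : IsSubmersionAt 𝓘(ℝ, E₁) 𝓘(ℝ, E₂) ∞ f p) :
    ∃ σ : E₂ → E₁, ContDiffAt ℝ ∞ σ (extChartAt 𝓘(ℝ, E₂) (f p) (f p)) ∧
      σ (extChartAt 𝓘(ℝ, E₂) (f p) (f p)) = extChartAt 𝓘(ℝ, E₁) p p ∧
      ∀ᶠ z in 𝓝 (extChartAt 𝓘(ℝ, E₂) (f p) (f p)), mapInChart E₁ E₂ f p (σ z) = z := by
  obtain ⟨s, hs, hsp, hfs⟩ := exists_local_section hf
  refine ⟨_, contDiffAt_inCharts hsp hs, ?_, ?_⟩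
  · rw [extChartAt_to_inv, hsp]
  · have h1 : ContinuousAt (extChartAt 𝓘(ℝ, E₂) (f p)).symm (extChartAt 𝓘(ℝ, E₂) (f p) (f p)) :=
      continuousAt_extChartAt_symm (f p)
    have h2 : ∀ᶠ q in 𝓝 (f p), s q ∈ (extChartAt 𝓘(ℝ, E₁) p).source :=
      hs.continuousAt.eventually_mem (by rw [hsp]; exact extChartAt_source_mem_nhds p)
    rw [ContinuousAt, extChartAt_to_inv] at h1
    filter_upwards [h1.eventually h2, h1.eventually hfs, chart_target_mem_nhds (f p)]
      with z hz hz' ht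
    rw [mapInChart, (extChartAt 𝓘(ℝ, E₁) p).left_inv hz, hz',
      (extChartAt 𝓘(ℝ, E₂) (f p)).right_inv ht]

theorem exists_chart_left_inverse {f : M₁ → M₂} {p : M₁}
    (hf : IsImmersionAt 𝓘(ℝ, E₁) 𝓘(ℝ, E₂) ∞ f p) :
    ∃ ρ : E₂ → E₁, ContDiffAt ℝ ∞ ρ (extChartAt 𝓘(ℝ, E₂) (f p) (f p)) ∧
      ∀ᶠ y in 𝓝 (extChartAt 𝓘(ℝ, E₁) p p), ρ (mapInChart E₁ E₂ f p y) = y := by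
  obtain ⟨r, hr, hrf⟩ := exists_local_left_inverse hf
  refine ⟨_, contDiffAt_inCharts hrf.self_of_nhds hr, ?_⟩
  have h1 : ContinuousAt (extChartAt 𝓘(ℝ, E₁) p).symm (extChartAt 𝓘(ℝ, E₁) p p) :=
    continuousAt_extChartAt_symm p
  rw [ContinuousAt, extChartAt_to_inv] at h1
  filter_upwards [h1.eventually hrf, eventually_mem_source (E₁ := E₁) (E₂ := E₂) hf.contMDiffAt.continuousAt]
    with y hy hy'
  rw [mapInChart, (extChartAt 𝓘(ℝ, E₂) (f p)).left_inv hy'.2, hy,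
    (extChartAt 𝓘(ℝ, E₁) p).right_inv hy'.1]

theorem fderiv_comp_eventually_id {F : E₁ → E₂} {σ : E₂ → E₁} {z : E₂} {y : E₁} (hy : σ z = y)
    (hσ : ContDiffAt ℝ ∞ σ z) (hF : ContDiffAt ℝ ∞ F y) (h : ∀ᶠ w in 𝓝 z, F (σ w) = w) :
    ∀ᶠ w in 𝓝 z, ∀ v, fderiv ℝ F (σ w) (fderiv ℝ σ w v) = v := by
  subst hy
  have h1 : ∀ᶠ w in 𝓝 z, DifferentiableAt ℝ σ w := by
    filter_upwards [(contDiffAt_infty.1 hσ 1).eventually (by simp)] with w hw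
    exact hw.differentiableAt (by simp)
  have h2 : ∀ᶠ w in 𝓝 z, DifferentiableAt ℝ F (σ w) := by
    filter_upwards [hσ.continuousAt.eventually ((contDiffAt_infty.1 hF 1).eventually (by simp))]
      with w hw
    exact hw.differentiableAt (by simp)
  filter_upwards [h1, h2, h.eventually_nhds] with w h1 h2 h3 v
  have h4 : F ∘ σ =ᶠ[𝓝 w] id := h3
  have h5 := h4.fderiv_eq (𝕜 := ℝ)
  rw [fderiv_comp w h2 h1, fderiv_id] at h5
  exact congrArg (fun T : E₂ →L[ℝ] E₂ => T v) h5

theorem dmap_surjective_of_isSubmersionAt {f : M₁ → M₂} {p : M₁}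
    (hf : IsSubmersionAt 𝓘(ℝ, E₁) 𝓘(ℝ, E₂) ∞ f p) : Function.Surjective (dmap E₁ E₂ f p) := by
  obtain ⟨σ, h1, h2, h3⟩ := exists_chart_section hf
  have h := (fderiv_comp_eventually_id h2 h1 (contDiffAt_mapInChart hf.contMDiffAt) h3).self_of_nhds
  intro v
  refine ⟨fderiv ℝ σ (extChartAt 𝓘(ℝ, E₂) (f p) (f p)) v, ?_⟩
  rw [← fderiv_mapInChart_self hf.contMDiffAt]
  rw [h2] at h
  exact h v

theorem dmap_injective_of_isImmersionAt {f : M₁ → M₂} {p : M₁}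
    (hf : IsImmersionAt 𝓘(ℝ, E₁) 𝓘(ℝ, E₂) ∞ f p) : Function.Injective (dmap E₁ E₂ f p) := by
  obtain ⟨ρ, h1, h2⟩ := exists_chart_left_inverse hf
  have h := (fderiv_comp_eventually_id (mapInChart_self f p)
    (contDiffAt_mapInChart hf.contMDiffAt) h1 h2).self_of_nhds
  rw [fderiv_mapInChart_self hf.contMDiffAt, mapInChart_self] at h
  exact Function.LeftInverse.injective h

end ChartSections

/-! ### Smoothness of induced tensors. -/

section Smoothness

universe u v
variable {E₁ : Type u} [NormedAddCommGroup E₁] [NormedSpace ℝ E₁] [FiniteDimensional ℝ E₁]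
variable {M₁ : Type*} [TopologicalSpace M₁] [ChartedSpace E₁ M₁]
variable {E₂ : Type v} [NormedAddCommGroup E₂] [NormedSpace ℝ E₂] [FiniteDimensional ℝ E₂]
variable {M₂ : Type*} [TopologicalSpace M₂] [ChartedSpace E₂ M₂]

omit [FiniteDimensional ℝ E₁] in
-- A linear map on a finite dimensional space is determined by its values on a basis, and this
-- correspondence is a continuous linear isomorphism.
theorem contDiffAt_of_clm_apply {G : Type*} [NormedAddCommGroup G] [NormedSpace ℝ G]
    {B : E₁ → E₂ →L[ℝ] G} {y : E₁} (h : ∀ v, ContDiffAt ℝ ∞ (fun z => B z v) y) :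
    ContDiffAt ℝ ∞ B y := by
  let d := Module.finrank ℝ E₂
  have hd : d = Module.finrank ℝ (Fin d → ℝ) := (Module.finrank_fin_fun ℝ).symm
  let e₁ := ContinuousLinearEquiv.ofFinrankEq hd
  let e₂ := (e₁.arrowCongr (1 : G ≃L[ℝ] G)).trans (ContinuousLinearEquiv.piRing (Fin d))
  rw [← id_comp B, ← e₂.symm_comp_self]
  exact e₂.symm.contDiff.contDiffAt.comp y (contDiffAt_pi.mpr fun i => h _)

omit [FiniteDimensional ℝ E₂] in
theorem contDiffAt_bilin_pullback {B : E₂ → E₂ →L[ℝ] E₂ →L[ℝ] ℝ}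
    {B' : E₁ → E₁ →L[ℝ] E₁ →L[ℝ] ℝ} {g : E₁ → E₂} {y : E₁} (hg : ContDiffAt ℝ ∞ g y)
    (hB : ContDiffAt ℝ ∞ B (g y))
    (h : ∀ᶠ z in 𝓝 y, ∀ v w, B' z v w = B (g z) (fderiv ℝ g z v) (fderiv ℝ g z w)) :
    ContDiffAt ℝ ∞ B' y := by
  have hg' : ContDiffAt ℝ ∞ (fderiv ℝ g) y := hg.fderiv_right (by simp)
  refine contDiffAt_of_clm_apply fun v => contDiffAt_of_clm_apply fun w => ?_
  refine ContDiffAt.congr_of_eventuallyEq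
    (f := fun z => B (g z) (fderiv ℝ g z v) (fderiv ℝ g z w)) ?_ ?_
  · exact ((hB.comp y hg).clm_apply (hg'.clm_apply contDiffAt_const)).clm_apply
      (hg'.clm_apply contDiffAt_const)
  · filter_upwards [h] with z hz using hz v w

variable [IsManifold 𝓘(ℝ, E₁) ∞ M₁] [IsManifold 𝓘(ℝ, E₂) ∞ M₂]

omit [FiniteDimensional ℝ E₂] in
theorem SmoothBilin.pullback {f : M₁ → M₂} (hf : ContMDiff 𝓘(ℝ, E₁) 𝓘(ℝ, E₂) ∞ f)
    {Ω₁ : BilinField E₁ M₁} {Ω₂ : BilinField E₂ M₂} (h₂ : SmoothBilin Ω₂)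
    (h : ∀ (p : M₁) (v w : Tan E₁ p), pullForm f Ω₂ p v w = Ω₁ p v w) : SmoothBilin Ω₁ := by
  intro p
  rw [smoothBilinAt_iff]
  refine contDiffAt_bilin_pullback (contDiffAt_mapInChart (hf p)) ?_ (pullForm_inChart hf h p)
  rw [mapInChart_self]
  exact (smoothBilinAt_iff Ω₂ (f p)).1 (h₂ (f p))

omit [FiniteDimensional ℝ E₁] in
-- Locally `Ω₂` is the pull-back of `Ω₁` along a section of the submersion.
theorem SmoothBilin.of_pullback {f : M₁ → M₂} (hf : IsSubmersion 𝓘(ℝ, E₁) 𝓘(ℝ, E₂) ∞ f)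
    (hsurj : Function.Surjective f)
    {Ω₁ : BilinField E₁ M₁} {Ω₂ : BilinField E₂ M₂} (h₁ : SmoothBilin Ω₁)
    (h : ∀ (p : M₁) (v w : Tan E₁ p), pullForm f Ω₂ p v w = Ω₁ p v w) : SmoothBilin Ω₂ := by
  intro x
  obtain ⟨p, rfl⟩ := hsurj x
  rw [smoothBilinAt_iff]
  obtain ⟨σ, h1, h2, h3⟩ := exists_chart_section (hf.isSubmersionAt p)
  have h4 := (smoothBilinAt_iff Ω₁ p).1 (h₁ p)
  rw [← h2] at h4
  refine contDiffAt_bilin_pullback h1 h4 ?_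
  have h5 := pullForm_inChart hf.contMDiff h p
  rw [← h2] at h5
  filter_upwards [h3, h1.continuousAt.eventually h5, fderiv_comp_eventually_id h2 h1
    (contDiffAt_mapInChart (hf.contMDiff p)) h3] with z e1 e2 e3 v w
  rw [e2, e1, e3, e3]

omit [FiniteDimensional ℝ E₂] in
-- Locally `a₁ = dρ ∘ a₂ ∘ df` for a left inverse `ρ` of `f`.
theorem SmoothEnd.of_immersion {f : M₁ → M₂} (hf : IsImmersion 𝓘(ℝ, E₁) 𝓘(ℝ, E₂) ∞ f)
    {a₁ : EndField E₁ M₁} {a₂ : EndField E₂ M₂} (h₂ : SmoothEnd a₂) (h : Intertwines a₁ a₂ f) :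
    SmoothEnd a₁ := by
  intro p
  rw [smoothEndAt_iff]
  have hF := contDiffAt_mapInChart (hf.contMDiff p)
  have hF' : ContDiffAt ℝ ∞ (fderiv ℝ (mapInChart E₁ E₂ f p)) (extChartAt 𝓘(ℝ, E₁) p p) :=
    hF.fderiv_right (by simp)
  obtain ⟨ρ, h1, h2⟩ := exists_chart_left_inverse (hf.isImmersionAt p)
  have h4 := (smoothEndAt_iff a₂ (f p)).1 (h₂ (f p))
  have h1' : ContDiffAt ℝ ∞ (fderiv ℝ ρ) (extChartAt 𝓘(ℝ, E₂) (f p) (f p)) :=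
    h1.fderiv_right (by simp)
  rw [← mapInChart_self (E₁ := E₁) (E₂ := E₂) f p] at h4 h1'
  refine contDiffAt_of_clm_apply fun v => ?_
  refine ContDiffAt.congr_of_eventuallyEq
    (f := fun y => fderiv ℝ ρ (mapInChart E₁ E₂ f p y)
      (endInChart a₂ (f p) (mapInChart E₁ E₂ f p y) (fderiv ℝ (mapInChart E₁ E₂ f p) y v))) ?_ ?_
  · exact (h1'.comp _ hF).clm_apply ((h4.comp _ hF).clm_apply (hF'.clm_apply contDiffAt_const))
  · filter_upwards [intertwines_inChart hf.contMDiff h p, fderiv_comp_eventually_id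
      (mapInChart_self f p) hF h1 h2] with y e1 e2
    rw [← e1, e2]

omit [FiniteDimensional ℝ E₁] in
-- Locally `a₂ = df ∘ a₁ ∘ dσ` for a section `σ` of `f`.
theorem SmoothEnd.of_submersion {f : M₁ → M₂} (hf : IsSubmersion 𝓘(ℝ, E₁) 𝓘(ℝ, E₂) ∞ f)
    (hsurj : Function.Surjective f)
    {a₁ : EndField E₁ M₁} {a₂ : EndField E₂ M₂} (h₁ : SmoothEnd a₁) (h : Intertwines a₁ a₂ f) :
    SmoothEnd a₂ := by
  intro x
  obtain ⟨p, rfl⟩ := hsurj x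
  rw [smoothEndAt_iff]
  have hF := contDiffAt_mapInChart (hf.contMDiff p)
  have hF' : ContDiffAt ℝ ∞ (fderiv ℝ (mapInChart E₁ E₂ f p)) (extChartAt 𝓘(ℝ, E₁) p p) :=
    hF.fderiv_right (by simp)
  obtain ⟨σ, h1, h2, h3⟩ := exists_chart_section (hf.isSubmersionAt p)
  have h1' : ContDiffAt ℝ ∞ (fderiv ℝ σ) (extChartAt 𝓘(ℝ, E₂) (f p) (f p)) :=
    h1.fderiv_right (by simp)
  have h4 := (smoothEndAt_iff a₁ p).1 (h₁ p)
  have h5 := intertwines_inChart hf.contMDiff h p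
  have h6 := fderiv_comp_eventually_id h2 h1 hF h3
  rw [← h2] at h4 h5 hF'
  refine contDiffAt_of_clm_apply fun v => ?_
  refine ContDiffAt.congr_of_eventuallyEq
    (f := fun z => fderiv ℝ (mapInChart E₁ E₂ f p) (σ z)
      (endInChart a₁ p (σ z) (fderiv ℝ σ z v))) ?_ ?_
  · exact (hF'.comp _ h1).clm_apply ((h4.comp _ h1).clm_apply (h1'.clm_apply contDiffAt_const))
  · filter_upwards [h3, h1.continuousAt.eventually h5, h6] with z e1 e2 e3
    rw [e2, e1, e3]

end Smoothness

/-! ### Descent of closed two-forms along submersions. -/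

section Descent

universe u v
variable {E₁ : Type u} [NormedAddCommGroup E₁] [NormedSpace ℝ E₁]
variable {M₁ : Type*} [TopologicalSpace M₁] [ChartedSpace E₁ M₁] [IsManifold 𝓘(ℝ, E₁) ∞ M₁]
variable {E₂ : Type v} [NormedAddCommGroup E₂] [NormedSpace ℝ E₂] [FiniteDimensional ℝ E₂]
variable {M₂ : Type*} [TopologicalSpace M₂] [ChartedSpace E₂ M₂] [IsManifold 𝓘(ℝ, E₂) ∞ M₂]

omit [IsManifold 𝓘(ℝ, E₁) ∞ M₁] in
theorem hasDerivWithinAt_extChartAt_comp {γ : ℝ → M₁} {V : VField E₁ M₁} {s : Set ℝ}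
    (hγ : IsMIntegralCurveOn (I := 𝓘(ℝ, E₁)) γ V s) {t : ℝ} (ht : t ∈ s) :
    HasDerivWithinAt (fun τ => extChartAt 𝓘(ℝ, E₁) (γ t) (γ τ)) (show E₁ from V (γ t)) s t := by
  have h := (hγ t ht).2
  simp only [writtenInExtChartAt, extChartAt_model_space_eq_id, PartialEquiv.refl_coe,
    PartialEquiv.refl_symm, modelWithCornersSelf_coe, range_id, inter_univ, preimage_id_eq, id_eq,
    comp_id] at h
  have h' : HasFDerivWithinAt (fun τ => extChartAt 𝓘(ℝ, E₁) (γ t) (γ τ))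
    (ContinuousLinearMap.smulRight (1 : ℝ →L[ℝ] ℝ) (show E₁ from V (γ t))) s t := h
  have h2 := h'.hasDerivWithinAt
  rwa [ContinuousLinearMap.smulRight_apply, one_apply_eq_self, one_smul] at h2

/-- Here `β p` is the form that `θ` at `p` induces on the tangent space of the base. Along a curve
inside a fibre that tangent space is fixed, so `β` can be differentiated, and
`fderiv_vertical_eq_zero` gives derivative zero. -/
theorem hasDerivWithinAt_descended {π : M₁ → M₂} (hπ : IsSubmersion 𝓘(ℝ, E₁) 𝓘(ℝ, E₂) ∞ π)
    {θ : BilinField E₁ M₁} (hθ : SmoothBilin θ)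
    (hskew : ∀ (p : M₁) (v w : Tan E₁ p), θ p v w = - θ p w v)
    (hd : ∀ (p : M₁) (u v w : E₁), extDerivAt θ p u v w = 0)
    (hker : ∀ (p : M₁) (k v : Tan E₁ p), dmap E₁ E₂ π p k = 0 → θ p k v = 0)
    {β : M₁ → E₂ → E₂ → ℝ}
    (hβ : ∀ (p : M₁) (v w : Tan E₁ p), β p (dmap E₁ E₂ π p v) (dmap E₁ E₂ π p w) = θ p v w)
    {γ : ℝ → M₁} {V : VField E₁ M₁} {s : Set ℝ} (hγ : IsMIntegralCurveOn (I := 𝓘(ℝ, E₁)) γ V s)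
    (hπγ : ∀ t ∈ s, ∀ τ ∈ s, π (γ t) = π (γ τ))
    (hV : ∀ t ∈ s, dmap E₁ E₂ π (γ t) (V (γ t)) = 0) (a b : E₂) {t : ℝ} (ht : t ∈ s) :
    HasDerivWithinAt (fun τ => β (γ τ) a b) 0 s t := by
  set p := γ t with hp
  have hF := contDiffAt_two_mapInChart (hπ.contMDiff p)
  have hF' := fderiv_mapInChart_self (hπ.contMDiff p)
  obtain ⟨K, hK⟩ := ContinuousLinearMap.exists_rightInverse_of_surjective
    (fderiv ℝ (mapInChart E₁ E₂ π p) (extChartAt 𝓘(ℝ, E₁) p p))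
    (LinearMap.range_eq_top.2 (by
      rw [hF']; exact dmap_surjective_of_isSubmersionAt (hπ.isSubmersionAt p)))
  obtain ⟨R, hR, hPR⟩ := eventually_comp_right_inverse K hF
    (fun a => congrArg (fun T : E₂ →L[ℝ] E₂ => T a) hK)
  have hθ' := hθ.differentiableAt p
  have hfr := eventually_chartFrame_fderiv hπ.contMDiff (p := p)
  have hsrc := eventually_mem_source (E₁ := E₁) (E₂ := E₂) (hπ.contMDiff.continuous.continuousAt (x := p))
  have hv := fderiv_vertical_eq_zero hF hθ' hR hPR
    (Filter.Eventually.of_forall fun y v w => by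
      rw [bilinInChart_apply, bilinInChart_apply]; exact hskew _ _ _)
    (hd p) (by
      filter_upwards [hfr] with y hy k w hk
      rw [bilinInChart_apply]
      apply hker
      rw [← hy, hk, map_zero]
      rfl) (k := V p) (by rw [hF']; exact hV t ht) a b
  have hH : DifferentiableAt ℝ (fun z => bilinInChart θ p z (R z a) (R z b))
      (extChartAt 𝓘(ℝ, E₁) p p) :=
    (hθ'.clm_apply (hR.clm_apply (differentiableAt_const a))).clm_apply
      (hR.clm_apply (differentiableAt_const b))
  have hc := hasDerivWithinAt_extChartAt_comp hγ ht
  have h1 := HasFDerivAt.comp_hasDerivWithinAt (l := fun z => bilinInChart θ p z (R z a) (R z b))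
    t hH.hasFDerivAt hc
  rw [hv] at h1
  -- Every `γ τ` projects to `π p`, where the chart frame is the identity; hence `R` really lifts
  -- `a` and `b` at each point of the curve.
  have key : ∀ᶠ τ in 𝓝[s] t, β (γ τ) a b
      = bilinInChart θ p (extChartAt 𝓘(ℝ, E₁) p (γ τ)) (R (extChartAt 𝓘(ℝ, E₁) p (γ τ)) a)
        (R (extChartAt 𝓘(ℝ, E₁) p (γ τ)) b) := by
    have hct := hc.continuousWithinAt
    have hγc : ContinuousWithinAt γ s t := (hγ t ht).1
    filter_upwards [hct.eventually hfr, hct.eventually hPR, self_mem_nhdsWithin,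
      hγc.eventually_mem (extChartAt_source_mem_nhds (I := 𝓘(ℝ, E₁)) p)] with τ e1 e2 e3 e4
    have e5 := (extChartAt 𝓘(ℝ, E₁) p).left_inv e4
    have e6 : mapInChart E₁ E₂ π p (extChartAt 𝓘(ℝ, E₁) p (γ τ))
        = extChartAt 𝓘(ℝ, E₂) (π p) (π p) := by
      rw [mapInChart, e5, hπγ τ e3 t ht]
    have e7 : ∀ c, dmap E₁ E₂ π ((extChartAt 𝓘(ℝ, E₁) p).symm (extChartAt 𝓘(ℝ, E₁) p (γ τ)))
        (chartFrame p (extChartAt 𝓘(ℝ, E₁) p (γ τ)) (R (extChartAt 𝓘(ℝ, E₁) p (γ τ)) c)) = c := by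
      intro c
      rw [← e1, e2, e6, chartFrame_self]
      rfl
    rw [bilinInChart_apply]
    refine Eq.trans ?_ (hβ _ _ _)
    rw [e7, e7, e5]
  exact h1.congr_of_eventuallyEq key (key.self_of_nhdsWithin ht)

omit [FiniteDimensional ℝ E₂] in
theorem bilin_apply_section {A : E₁ →L[ℝ] E₂} {K : E₂ →L[ℝ] E₁} {T : E₁ →L[ℝ] E₁ →L[ℝ] ℝ}
    (hK : ∀ a, A (K a) = a) (hker : ∀ k w, A k = 0 → T k w = 0)
    (hskew : ∀ v w, T v w = - T w v) (v w : E₁) : T (K (A v)) (K (A w)) = T v w := by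
  have h1 : ∀ v w, T (K (A v)) w = T v w := by
    intro v w
    have h2 := hker (K (A v) - v) w (by rw [map_sub, hK, sub_self])
    rw [map_sub, _root_.sub_apply, sub_eq_zero] at h2
    exact h2
  rw [h1, hskew, h1, ← hskew]

/-- A closed two-form whose kernel contains the vertical vectors descends along a submersion with
fibres connected by vertical curves. -/
theorem exists_descended_form {π : M₁ → M₂} (hπ : IsSubmersion 𝓘(ℝ, E₁) 𝓘(ℝ, E₂) ∞ π)
    (hsurj : Function.Surjective π)
    {θ : BilinField E₁ M₁} (hθ : SmoothBilin θ)
    (hskew : ∀ (p : M₁) (v w : Tan E₁ p), θ p v w = - θ p w v)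
    (hd : ∀ (p : M₁) (u v w : E₁), extDerivAt θ p u v w = 0)
    (hker : ∀ (p : M₁) (k v : Tan E₁ p), dmap E₁ E₂ π p k = 0 → θ p k v = 0)
    (hfib : ∀ p q, π p = π q → Relation.EqvGen (fun p q => ∃ (V : VField E₁ M₁) (γ : ℝ → M₁),
      IsMIntegralCurveOn (I := 𝓘(ℝ, E₁)) γ V (Icc 0 1) ∧ γ 0 = p ∧ γ 1 = q ∧
      (∀ t ∈ Icc (0 : ℝ) 1, π (γ t) = π p) ∧
      ∀ t ∈ Icc (0 : ℝ) 1, dmap E₁ E₂ π (γ t) (V (γ t)) = 0) p q) :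
    ∃ Ω : BilinField E₂ M₂, ∀ (p : M₁) (v w : Tan E₁ p), pullForm π Ω p v w = θ p v w := by
  have hK : ∀ p, ∃ K : E₂ →L[ℝ] E₁, ∀ a, (show E₁ →L[ℝ] E₂ from dmap E₁ E₂ π p) (K a) = a := by
    intro p
    obtain ⟨K, hK⟩ := ContinuousLinearMap.exists_rightInverse_of_surjective
      (show E₁ →L[ℝ] E₂ from dmap E₁ E₂ π p)
      (LinearMap.range_eq_top.2 (dmap_surjective_of_isSubmersionAt (hπ.isSubmersionAt p)))
    exact ⟨K, fun a => congrArg (fun T : E₂ →L[ℝ] E₂ => T a) hK⟩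
  choose K hK using hK
  -- The right inverses `K p` are chosen pointwise without any regularity; this is harmless, since
  -- by `hB` the form `B p` is determined by `θ` at `p`.
  let B : M₁ → E₂ →L[ℝ] E₂ →L[ℝ] ℝ := fun p => (ContinuousLinearMap.precomp ℝ (K p)).comp
    ((show E₁ →L[ℝ] E₁ →L[ℝ] ℝ from θ p).comp (K p))
  have hB : ∀ (p : M₁) (v w : Tan E₁ p),
      B p (dmap E₁ E₂ π p v) (dmap E₁ E₂ π p w) = θ p v w := by
    intro p v w
    exact bilin_apply_section (E₁ := E₁) (E₂ := E₂) (A := dmap E₁ E₂ π p) (T := θ p) (hK p) (hker p) (hskew p) v w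
  have hinv : ∀ p q, Relation.EqvGen (fun p q => ∃ (V : VField E₁ M₁) (γ : ℝ → M₁),
      IsMIntegralCurveOn (I := 𝓘(ℝ, E₁)) γ V (Icc 0 1) ∧ γ 0 = p ∧ γ 1 = q ∧
      (∀ t ∈ Icc (0 : ℝ) 1, π (γ t) = π p) ∧
      ∀ t ∈ Icc (0 : ℝ) 1, dmap E₁ E₂ π (γ t) (V (γ t)) = 0) p q → B p = B q := by
    intro p q hpq
    induction hpq with
    | rel p q h =>
      obtain ⟨V, γ, hγ, rfl, rfl, h1, h2⟩ := h
      ext a b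
      have hder : ∀ t ∈ Icc (0 : ℝ) 1,
          HasDerivWithinAt (fun τ => B (γ τ) a b) 0 (Icc 0 1) t := fun t ht =>
        hasDerivWithinAt_descended hπ hθ hskew hd hker (β := fun p a b => B p a b) hB hγ
          (fun t ht τ hτ => (h1 t ht).trans (h1 τ hτ).symm) h2 a b ht
      refine (constant_of_derivWithin_zero (f := fun τ => B (γ τ) a b) (a := 0) (b := 1)
        (fun t ht => (hder t ht).differentiableWithinAt) (fun t ht => ?_) 1 (by simp)).symm
      exact (hder t ⟨ht.1, ht.2.le⟩).derivWithin (uniqueDiffOn_Icc one_pos t ⟨ht.1, ht.2.le⟩)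
    | refl p => rfl
    | symm p q _ ih => exact ih.symm
    | trans p q r _ _ ih1 ih2 => exact ih1.trans ih2
  -- Any preimage of `z` may be used, as `B` is constant on fibres.
  refine ⟨fun z => B (Function.surjInv hsurj z), fun p v w => ?_⟩
  rw [← hB p v w, hinv p _ (hfib _ _ (Function.surjInv_eq hsurj (π p)).symm)]
  rfl

end Descent

/-! ### The tangent space of a regular level set. -/

section LevelSet

/-- The implicit function theorem parametrizes the fibre by `Ker f'`, with the inclusion of `Ker f'`
as derivative; the curve is the image of the line `t ↦ t • v`. -/
theorem exists_curve_in_fiber {E F : Type*} [NormedAddCommGroup E] [NormedSpace ℝ E]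
    [FiniteDimensional ℝ E] [NormedAddCommGroup F] [NormedSpace ℝ F] [FiniteDimensional ℝ F]
    {f : E → F} {f' : E →L[ℝ] F} {y v : E} (hf : HasStrictFDerivAt f f' y)
    (hf' : Function.Surjective f') (hv : f' v = 0) :
    ∃ c : ℝ → E, c 0 = y ∧ HasDerivAt c v 0 ∧ ∀ᶠ t in 𝓝 0, f (c t) = f y := by
  have : CompleteSpace E := FiniteDimensional.complete ℝ E
  have : CompleteSpace F := FiniteDimensional.complete ℝ F
  have hr : f'.range = ⊤ := LinearMap.range_eq_top.2 hf'
  let g := hf.implicitFunction f f' hr (f y)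
  let k : f'.ker := ⟨v, hv⟩
  have hl : HasDerivAt (fun t : ℝ => t • k) k 0 := by
    simpa using (hasDerivAt_id (0 : ℝ)).smul_const k
  have h0 : (fun t : ℝ => t • k) 0 = 0 := zero_smul ℝ k
  refine ⟨fun t => g (t • k), ?_, ?_, ?_⟩
  · simp [g]
  · have h1 := (hf.to_implicitFunction hr).hasFDerivAt
    rw [← h0] at h1
    exact HasFDerivAt.comp_hasDerivAt (0 : ℝ) h1 hl
  · have h1 := hf.map_implicitFunction_eq hr
    have h2 : Filter.Tendsto (fun t : ℝ => (f y, t • k)) (𝓝 0) (𝓝 (f y, 0)) := by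
      have h3 := hl.continuousAt.tendsto
      rw [zero_smul] at h3
      exact tendsto_const_nhds.prodMk_nhds h3
    exact h2.eventually h1

universe u v
variable {ES : Type u} [NormedAddCommGroup ES] [NormedSpace ℝ ES] [FiniteDimensional ℝ ES]
variable {S : Type*} [TopologicalSpace S] [ChartedSpace ES S]
variable {EM : Type*} [NormedAddCommGroup EM] [NormedSpace ℝ EM] [FiniteDimensional ℝ EM]
variable {M : Type*} [TopologicalSpace M] [ChartedSpace EM M]
variable {EC : Type v} [NormedAddCommGroup EC] [NormedSpace ℝ EC]
variable {μ : S → M} {x : M} [ChartedSpace EC (μ ⁻¹' {x})]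

/-- The tangent space of a regular level set is the kernel of the differential. -/
theorem exists_dmap_incl_eq (hμ : ContMDiff 𝓘(ℝ, ES) 𝓘(ℝ, EM) ∞ μ) (p : μ ⁻¹' {x})
    (hsurj : Function.Surjective (dmap ES EM μ (p : S)))
    (hC : IsImmersionAt 𝓘(ℝ, EC) 𝓘(ℝ, ES) ∞ (incl μ x) p)
    (v : Tan ES (p : S)) (hv : dmap ES EM μ (p : S) v = 0) :
    ∃ w : Tan EC p, dmap EC ES (incl μ x) p w = v := by
  have hF := contDiffAt_mapInChart (hμ (p : S))
  have hF' := fderiv_mapInChart_self (hμ (p : S))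
  obtain ⟨c, hc0, hc, hcF⟩ := exists_curve_in_fiber (E := ES) (F := EM) (v := v)
    (hF.hasStrictFDerivAt (by simp)) (by rw [hF']; exact hsurj) (by rw [hF']; exact hv)
  obtain ⟨ρ, hρ, hρI⟩ := exists_chart_left_inverse hC
  have hI := contDiffAt_mapInChart hC.contMDiffAt
  have hρ0 : ρ (extChartAt 𝓘(ℝ, ES) (p : S) p) = extChartAt 𝓘(ℝ, EC) p p := by
    have := hρI.self_of_nhds
    rwa [mapInChart_self] at this
  -- In coordinates, the inclusion after `ρ` fixes the points of `𝒞` near `p`. A curve `c` in `𝒞`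
  -- therefore equals the inclusion of `ρ ∘ c`, and `v` is the image of the velocity of `ρ ∘ c`.
  have h1 : ∀ᶠ q : μ ⁻¹' {x} in 𝓝 p,
      mapInChart EC ES (incl μ x) p (ρ (extChartAt 𝓘(ℝ, ES) (p : S) (q : S)))
      = extChartAt 𝓘(ℝ, ES) (p : S) (q : S) := by
    filter_upwards [(continuousAt_extChartAt (I := 𝓘(ℝ, EC)) p).eventually hρI,
      extChartAt_source_mem_nhds (I := 𝓘(ℝ, EC)) p] with q hq hq'
    have h2 : mapInChart EC ES (incl μ x) p (extChartAt 𝓘(ℝ, EC) p q)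
        = extChartAt 𝓘(ℝ, ES) (p : S) (q : S) := by
      rw [mapInChart, (extChartAt 𝓘(ℝ, EC) p).left_inv hq']
    rw [← h2, hq]
  -- `𝒞` has the subspace topology, so nearness to `p` may be checked in `S`, where the curve is
  -- known to be continuous.
  rw [nhds_induced, Filter.eventually_comap] at h1
  have h3 : Filter.Tendsto (fun t => (extChartAt 𝓘(ℝ, ES) (p : S)).symm (c t)) (𝓝 0)
      (𝓝 (p : S)) := by
    have h4 := continuousAt_extChartAt_symm (I := 𝓘(ℝ, ES)) (p : S)
    rw [ContinuousAt, extChartAt_to_inv] at h4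
    have h5 := hc.continuousAt.tendsto
    rw [hc0] at h5
    exact h4.comp h5
  have h6 : ∀ᶠ s in 𝓝 (p : S), μ s ∈ (extChartAt 𝓘(ℝ, EM) (μ p)).source :=
    hμ.continuous.continuousAt.eventually_mem (extChartAt_source_mem_nhds (μ p))
  have h7 : ∀ᶠ t in 𝓝 (0 : ℝ), mapInChart EC ES (incl μ x) p (ρ (c t)) = c t := by
    have h8 : ∀ᶠ t in 𝓝 (0 : ℝ), c t ∈ (extChartAt 𝓘(ℝ, ES) (p : S)).target :=
      hc.continuousAt.eventually_mem (by rw [hc0]; exact chart_target_mem_nhds (p : S))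
    filter_upwards [h3.eventually h1, h3.eventually h6, hcF, h8] with t e1 e2 e3 e4
    rw [mapInChart_self] at e3
    have e5 := (extChartAt 𝓘(ℝ, EM) (μ p)).injOn e2 (mem_extChartAt_source (μ p)) e3
    have e6 := e1 ⟨_, e5.trans p.2⟩ rfl
    simp only [(extChartAt 𝓘(ℝ, ES) (p : S)).right_inv e4] at e6
    exact e6
  have h9 : HasDerivAt (fun t => mapInChart EC ES (incl μ x) p (ρ (c t))) v 0 :=
    hc.congr_of_eventuallyEq h7
  have hρd : HasFDerivAt ρ (fderiv ℝ ρ (extChartAt 𝓘(ℝ, ES) (p : S) p)) (c 0) := by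
    rw [hc0]
    exact (hρ.differentiableAt (by simp)).hasFDerivAt
  have hρc := HasFDerivAt.comp_hasDerivAt (0 : ℝ) hρd hc
  have hId : HasFDerivAt (mapInChart EC ES (incl μ x) p) (dmap EC ES (incl μ x) p) ((ρ ∘ c) 0) := by
    rw [comp_apply, hc0, hρ0, ← fderiv_mapInChart_self hC.contMDiffAt]
    exact (hI.differentiableAt (by simp)).hasFDerivAt
  have h10 := HasFDerivAt.comp_hasDerivAt (0 : ℝ) hId hρc
  exact ⟨_, h10.unique h9⟩

omit [FiniteDimensional ℝ ES] [FiniteDimensional ℝ EM] in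
theorem dmap_dmap_incl (hμ : ContMDiff 𝓘(ℝ, ES) 𝓘(ℝ, EM) ∞ μ)
    (hC : ContMDiff 𝓘(ℝ, EC) 𝓘(ℝ, ES) ∞ (incl μ x)) (p : μ ⁻¹' {x}) (w : Tan EC p) :
    dmap ES EM μ (p : S) (dmap EC ES (incl μ x) p w) = 0 := by
  have h1 := mfderiv_comp p ((hμ _).mdifferentiableAt (by simp)) ((hC p).mdifferentiableAt (by simp))
  have h2 : μ ∘ incl μ x = fun _ => x := funext fun q => q.2
  rw [h2, mfderiv_const] at h1
  exact (congrArg (fun T : EC →L[ℝ] EM => T w) h1).symm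

end LevelSet

/-! ### Linear algebra in finite dimensions. -/

section LinearAlgebra

variable {E F : Type*} [NormedAddCommGroup E] [NormedSpace ℝ E] [FiniteDimensional ℝ E]
variable [NormedAddCommGroup F] [NormedSpace ℝ F]

theorem isInvertible_of_nondegenerate {T : E →L[ℝ] E →L[ℝ] ℝ}
    (h : ∀ v, (∀ w, T v w = 0) → v = 0) : T.IsInvertible := by
  have hinj : Function.Injective T := by
    refine (injective_iff_map_eq_zero T).2 fun v hv => h v fun w => ?_
    rw [hv]; rfl
  let e : (E →L[ℝ] ℝ) ≃ₗ[ℝ] (E →ₗ[ℝ] ℝ) := LinearMap.toContinuousLinearMap.symm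
  have hd : Module.finrank ℝ E = Module.finrank ℝ (E →L[ℝ] ℝ) := by
    rw [e.finrank_eq]
    exact (Subspace.dual_finrank_eq (K := ℝ) (V := E)).symm
  have : FiniteDimensional ℝ (E →L[ℝ] ℝ) := e.symm.finiteDimensional
  exact ⟨(LinearEquiv.ofInjectiveOfFinrankEq T.toLinearMap hinj hd).toContinuousLinearEquiv, rfl⟩

omit [FiniteDimensional ℝ E] in
theorem exists_clm_right_inverse [FiniteDimensional ℝ F] {A : E →L[ℝ] F}
    (hA : Function.Surjective A) : ∃ K : F →L[ℝ] E, ∀ v, A (K v) = v := by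
  obtain ⟨K, hK⟩ := ContinuousLinearMap.exists_rightInverse_of_surjective A
    (LinearMap.range_eq_top.2 hA)
  exact ⟨K, fun a => congrArg (fun T : F →L[ℝ] F => T a) hK⟩

omit [FiniteDimensional ℝ E] in
theorem exists_clm_left_inverse [FiniteDimensional ℝ F] {A : E →L[ℝ] F}
    (hA : Function.Injective A) : ∃ L : F →L[ℝ] E, ∀ v, L (A v) = v := by
  obtain ⟨L, hL⟩ := A.toLinearMap.exists_leftInverse_of_injective (LinearMap.ker_eq_bot.2 hA)
  exact ⟨LinearMap.toContinuousLinearMap L, fun a => congrArg (fun T : E →ₗ[ℝ] E => T a) hL⟩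

omit [FiniteDimensional ℝ E] in
theorem exists_clm_comp_eq [FiniteDimensional ℝ F] {A : E →L[ℝ] F} (hA : Function.Surjective A)
    {T : E →L[ℝ] ℝ} (hT : ∀ v, A v = 0 → T v = 0) : ∃ ξ : F →L[ℝ] ℝ, T = ξ.comp A := by
  obtain ⟨K, hK⟩ := exists_clm_right_inverse hA
  refine ⟨T.comp K, ContinuousLinearMap.ext fun v => ?_⟩
  have h := hT (v - K (A v)) (by rw [map_sub, hK, sub_self])
  rw [map_sub, sub_eq_zero] at h
  exact h

end LinearAlgebra

theorem differentiableAt_neg_add {E G : Type*} [NormedAddCommGroup E] [NormedSpace ℝ E]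
    [NormedAddCommGroup G] [NormedSpace ℝ G] {f g : E → G} {y : E} (hf : DifferentiableAt ℝ f y)
    (hg : DifferentiableAt ℝ g y) : DifferentiableAt ℝ (-(f + g)) y :=
  (hf.add hg).neg

theorem fderiv_neg_add_apply {E G : Type*} [NormedAddCommGroup E] [NormedSpace ℝ E]
    [NormedAddCommGroup G] [NormedSpace ℝ G] {f g : E → G} {y : E} (hf : DifferentiableAt ℝ f y)
    (hg : DifferentiableAt ℝ g y) (u : E) :
    fderiv ℝ (-(f + g)) y u = -(fderiv ℝ f y u + fderiv ℝ g y u) := by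
  rw [fderiv_neg, fderiv_add hf hg]
  rfl

theorem flatExtDeriv_neg_add {E : Type*} [NormedAddCommGroup E] [NormedSpace ℝ E]
    {η θ : E → E →L[ℝ] E →L[ℝ] ℝ} {y : E} (hη : DifferentiableAt ℝ η y)
    (hθ : DifferentiableAt ℝ θ y) (u v w : E) :
    flatExtDeriv (-(η + θ)) y u v w = -(flatExtDeriv η y u v w + flatExtDeriv θ y u v w) := by
  have h : ∀ u v w, fderiv ℝ (-(η + θ)) y u v w = -(fderiv ℝ η y u v w + fderiv ℝ θ y u v w) :=
    fun u v w => congrArg (fun T : E →L[ℝ] E →L[ℝ] ℝ => T v w)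
      (fderiv_neg_add_apply (G := E →L[ℝ] E →L[ℝ] ℝ) hη hθ u)
  simp only [flatExtDeriv, h]
  ring

/-! ### The torsion of a Hitchin pair. -/

section Pairs

variable {E : Type*} [NormedAddCommGroup E] [NormedSpace ℝ E]
variable {M : Type*} [TopologicalSpace M] [ChartedSpace E M] [IsManifold 𝓘(ℝ, E) ∞ M]

theorem IsSymplectic.skew {Ω : BilinField E M} (h : IsSymplectic Ω) (p : M) (v w : Tan E p) :
    Ω p v w = - Ω p w v := by
  have core : ∀ (T : E →L[ℝ] E →L[ℝ] ℝ), (∀ v, T v v = 0) → ∀ v w, T v w = - T w v := by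
    intro T hT v w
    have h1 := hT (v + w)
    simp only [map_add, _root_.add_apply, hT] at h1
    linarith
  exact core (Ω p) (h.alternating p) v w

omit [IsManifold 𝓘(ℝ, E) ∞ M] in
theorem Commutes.skew {Ω : BilinField E M} {a : EndField E M} (h : Commutes Ω a)
    (hΩ : ∀ (p : M) (v w : Tan E p), Ω p v w = - Ω p w v) (p : M) (v w : Tan E p) :
    Ω p (a p v) w = - Ω p (a p w) v := by
  rw [hΩ, ← h]

theorem bilinInChart_comp_end (Ω : BilinField E M) (a : EndField E M) {p : M} {y : E}
    (hy : y ∈ (extChartAt 𝓘(ℝ, E) p).target) :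
    bilinInChart (fun q => (Ω q).comp (a q)) p y
      = (bilinInChart Ω p y).comp (endInChart a p y) := by
  ext v w
  rw [ContinuousLinearMap.comp_apply, bilinInChart_apply, bilinInChart_apply,
    chartFrame_endInChart a hy]
  rfl

theorem SmoothBilin.comp_end {Ω : BilinField E M} {a : EndField E M} (hΩ : SmoothBilin Ω)
    (ha : SmoothEnd a) : SmoothBilin (fun q => (Ω q).comp (a q)) := by
  intro p
  rw [smoothBilinAt_iff]
  have h1 := (smoothBilinAt_iff Ω p).1 (hΩ p)
  have h2 := (smoothEndAt_iff a p).1 (ha p)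
  refine (h1.clm_comp h2).congr_of_eventuallyEq ?_
  filter_upwards [chart_target_mem_nhds p] with y hy
  exact bilinInChart_comp_end Ω a hy

theorem isClosedForm_iff_extDerivAt {Ω : BilinField E M} (hΩ : SmoothBilin Ω)
    (hskew : ∀ (p : M) (v w : Tan E p), Ω p v w = - Ω p w v) :
    IsClosedForm Ω ↔ ∀ (p : M) (u v w : E), extDerivAt Ω p u v w = 0 :=
  isClosedForm_iff hΩ hskew

omit [IsManifold 𝓘(ℝ, E) ∞ M] in
theorem twist_apply (Ω : BilinField E M) (a : EndField E M) (p : M) (v w : Tan E p) :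
    twist Ω a p v w = -(Ω p v w + Ω p (a p v) (a p w)) := rfl

/-- The torsion of the `(1,1)`-tensor of a Hitchin pair is dual to the differential of its twist. -/
theorem IsHitchinPair.apply_torsionAt {Ω : BilinField E M} {a : EndField E M}
    (h : IsHitchinPair Ω a) (hσ : SmoothBilin (twist Ω a)) (p : M) (u v w : E) :
    (show E →L[ℝ] E →L[ℝ] ℝ from Ω p) (torsionAt a p u v) w = extDerivAt (twist Ω a) p u v w := by
  have hs := h.symplectic
  have hΩ' := hs.smooth.differentiableAt p
  have hσ' := hσ.differentiableAt p
  have ha' := h.smooth.differentiableAt p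
  have hdΩ := (isClosedForm_iff_extDerivAt hs.smooth hs.skew).1 hs.closed p
  have hdΩa := (isClosedForm_iff_extDerivAt (hs.smooth.comp_end h.smooth)
    (h.commutes.skew hs.skew)).1 h.closed p
  have hev : bilinInChart (fun q => (Ω q).comp (a q)) p =ᶠ[𝓝 (extChartAt 𝓘(ℝ, E) p p)]
      fun y => (bilinInChart Ω p y).comp (endInChart a p y) := by
    filter_upwards [chart_target_mem_nhds p] with y hy using bilinInChart_comp_end Ω a hy
  -- By definition of the twist, `-(σ + Ω)` is `a^*Ω`. Since `dΩ = 0`, minus its exterior derivative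
  -- is `dσ`.
  have key := bilin_flatTorsion (θ := -(bilinInChart (twist Ω a) p + bilinInChart Ω p)) hΩ' ha' (differentiableAt_neg_add (G := E →L[ℝ] E →L[ℝ] ℝ) hσ' hΩ')
    (Filter.Eventually.of_forall fun y v w => by
      rw [bilinInChart_apply, bilinInChart_apply]; exact hs.skew _ _ _)
    (by
      filter_upwards [chart_target_mem_nhds p] with y hy v w
      rw [bilinInChart_apply, bilinInChart_apply, chartFrame_endInChart a hy,
        chartFrame_endInChart a hy]
      exact h.commutes _ _ _)
    hdΩ (fun u v w => by
      have := hdΩa u v w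
      rwa [extDerivAt, flatExtDeriv, hev.fderiv_eq] at this)
    (by
      filter_upwards [chart_target_mem_nhds p] with y hy v w
      change -(bilinInChart (twist Ω a) p y v w + bilinInChart Ω p y v w) = _
      rw [bilinInChart_apply, bilinInChart_apply, bilinInChart_apply, chartFrame_endInChart a hy,
        chartFrame_endInChart a hy]
      refine (congrArg (fun t : ℝ => -(t + _)) (twist_apply Ω a _ _ _)).trans ?_
      rw [neg_add_rev, neg_neg]
      exact neg_add_cancel_left _ _) u v w
  rw [bilinInChart_self] at key
  refine key.trans ?_
  have h3 := hdΩ u v w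
  rw [extDerivAt] at h3
  rw [flatExtDeriv_neg_add hσ' hΩ', h3, extDerivAt]
  ring

end Pairs

/-! ### Restriction along immersions and uniqueness along submersions. -/

section Restriction

universe u v
variable {E₁ : Type u} [NormedAddCommGroup E₁] [NormedSpace ℝ E₁] [FiniteDimensional ℝ E₁]
variable {M₁ : Type*} [TopologicalSpace M₁] [ChartedSpace E₁ M₁]
variable {E₂ : Type v} [NormedAddCommGroup E₂] [NormedSpace ℝ E₂] [FiniteDimensional ℝ E₂]
variable {M₂ : Type*} [TopologicalSpace M₂] [ChartedSpace E₂ M₂]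

omit [FiniteDimensional ℝ E₁] in
theorem exists_restricted_end {f : M₁ → M₂} {a : EndField E₂ M₂}
    (hinj : ∀ p, Function.Injective (dmap E₁ E₂ f p))
    (h : ∀ (p : M₁) (v : Tan E₁ p), ∃ w : Tan E₁ p,
      dmap E₁ E₂ f p w = a (f p) (dmap E₁ E₂ f p v)) :
    ∃ a' : EndField E₁ M₁, Intertwines a' a f := by
  have core : ∀ p, ∃ B : E₁ →L[ℝ] E₁, ∀ v, (show E₁ →L[ℝ] E₂ from dmap E₁ E₂ f p) (B v)
      = (show E₂ →L[ℝ] E₂ from a (f p)) ((show E₁ →L[ℝ] E₂ from dmap E₁ E₂ f p) v) := by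
    intro p
    obtain ⟨L, hL⟩ := exists_clm_left_inverse (A := (show E₁ →L[ℝ] E₂ from dmap E₁ E₂ f p)) (hinj p)
    refine ⟨L.comp ((show E₂ →L[ℝ] E₂ from a (f p)).comp
      (show E₁ →L[ℝ] E₂ from dmap E₁ E₂ f p)), fun v => ?_⟩
    obtain ⟨w, hw⟩ : ∃ w : E₁, (show E₁ →L[ℝ] E₂ from dmap E₁ E₂ f p) w
      = (show E₂ →L[ℝ] E₂ from a (f p)) ((show E₁ →L[ℝ] E₂ from dmap E₁ E₂ f p) v) := h p v
    rw [ContinuousLinearMap.comp_apply, ContinuousLinearMap.comp_apply, ← hw, hL]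
  choose B hB using core
  exact ⟨B, hB⟩

omit [FiniteDimensional ℝ E₁] [FiniteDimensional ℝ E₂] in
theorem eq_of_pullForm_eq {f : M₁ → M₂} (hsurj : Function.Surjective f)
    (hd : ∀ p, Function.Surjective (dmap E₁ E₂ f p)) {Ω Ω' : BilinField E₂ M₂}
    (h : ∀ (p : M₁) (v w : Tan E₁ p), pullForm f Ω p v w = pullForm f Ω' p v w) : Ω = Ω' := by
  funext z
  obtain ⟨p, rfl⟩ := hsurj z
  ext v w
  obtain ⟨v, rfl⟩ := hd p v
  obtain ⟨w, rfl⟩ := hd p w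
  exact h p v w

omit [FiniteDimensional ℝ E₁] [FiniteDimensional ℝ E₂] in
theorem eq_of_intertwines {f : M₁ → M₂} (hsurj : Function.Surjective f)
    (hd : ∀ p, Function.Surjective (dmap E₁ E₂ f p)) {a : EndField E₁ M₁} {J J' : EndField E₂ M₂}
    (h : Intertwines a J f) (h' : Intertwines a J' f) : J = J' := by
  funext z
  obtain ⟨p, rfl⟩ := hsurj z
  ext v
  obtain ⟨v, rfl⟩ := hd p v
  exact (h p v).symm.trans (h' p v)

end Restriction

/-! ### Orbits of the isotropy algebra. -/

section Isotropy

variable {ES : Type*} [NormedAddCommGroup ES] [NormedSpace ℝ ES]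
variable {S : Type*} [TopologicalSpace S] [ChartedSpace ES S]
variable {EM : Type*} [NormedAddCommGroup EM] [NormedSpace ℝ EM]
variable {M : Type*} [TopologicalSpace M] [ChartedSpace EM M]
variable {EC : Type*} [NormedAddCommGroup EC] [NormedSpace ℝ EC]
variable {μ : S → M} {x : M}

omit [TopologicalSpace S] in
theorem exists_covectorAt_eq (𝒥 : GenEnd EM M) (p : μ ⁻¹' {x}) (ξ : Cot EM (μ (p : S)))
    (h : compPi 𝒥 (μ (p : S)) ξ = 0) : ∃ α ∈ isotropy 𝒥 x, covectorAt α p = ξ := by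
  obtain ⟨s, hs⟩ := p
  obtain rfl : μ s = x := hs
  exact ⟨ξ, h, rfl⟩

omit [TopologicalSpace S] in
theorem covectorAt_smul (t : ℝ) (α : Cot EM x) (p : μ ⁻¹' {x}) :
    covectorAt (t • α) p = t • covectorAt α p := by
  obtain ⟨s, hs⟩ := p
  obtain rfl : μ s = x := hs
  rfl

variable [ChartedSpace EC (μ ⁻¹' {x})] {Ω : BilinField ES S}

theorem IsAction.smul {α : Cot EM x} {p : μ ⁻¹' {x}} {v : Tan EC p} (h : IsAction Ω α p v)
    (t : ℝ) : IsAction Ω (t • α) p (t • v) := by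
  rw [IsAction] at h ⊢
  rw [covectorAt_smul, map_smul, map_smul, h]
  rfl

/-- The generating curves of the orbit relation stay in their orbit. -/
theorem proj_eq_of_isAction {𝒥 : GenEnd EM M} {α : Cot EM x} (hα : α ∈ isotropy 𝒥 x)
    {V : VField EC (μ ⁻¹' {x})} (hV : ∀ r, IsAction Ω α r (V r)) {γ : ℝ → μ ⁻¹' {x}}
    (hγ : IsMIntegralCurveOn (I := 𝓘(ℝ, EC)) γ V (Icc 0 1)) {t : ℝ} (ht : t ∈ Icc (0 : ℝ) 1) :
    proj EC Ω 𝒥 μ x (γ t) = proj EC Ω 𝒥 μ x (γ 0) := by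
  -- The point `γ t` is reached at time one by `s ↦ γ (s * t)`, an integral curve of `t • V`, which
  -- represents the action of `t • α`.
  refine (Quotient.sound (Relation.EqvGen.rel _ _ ⟨t • α, Submodule.smul_mem _ t hα, t • V,
    fun r => (hV r).smul t, γ ∘ (· * t), (hγ.comp_mul t).mono fun s hs => ?_, ?_, ?_⟩)).symm
  · exact ⟨mul_nonneg hs.1 ht.1, mul_le_one₀ hs.2 ht.1 ht.2⟩
  · simp
  · simp

/-- Supplies the connectedness of fibres required by `exists_descended_form`: the generating curves
stay in one fibre and their velocities, being directions of the action, are vertical. -/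
theorem eqvGen_vertical_curves {𝒥 : GenEnd EM M}
    {EQ : Type*} [NormedAddCommGroup EQ] [NormedSpace ℝ EQ]
    [ChartedSpace EQ (OrbitSpace EC Ω 𝒥 μ x)] [IsManifold 𝓘(ℝ, ES) ∞ S]
    (hQ : IsSmoothQuotient (EC := EC) (EQ := EQ) Ω 𝒥 μ x) (p q : μ ⁻¹' {x})
    (hpq : proj EC Ω 𝒥 μ x p = proj EC Ω 𝒥 μ x q) :
    Relation.EqvGen (fun p q => ∃ (V : VField EC (μ ⁻¹' {x})) (γ : ℝ → μ ⁻¹' {x}),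
      IsMIntegralCurveOn (I := 𝓘(ℝ, EC)) γ V (Icc 0 1) ∧ γ 0 = p ∧ γ 1 = q ∧
      (∀ t ∈ Icc (0 : ℝ) 1, proj EC Ω 𝒥 μ x (γ t) = proj EC Ω 𝒥 μ x p) ∧
      ∀ t ∈ Icc (0 : ℝ) 1, dmap EC EQ (proj EC Ω 𝒥 μ x) (γ t) (V (γ t)) = 0) p q := by
  refine Relation.EqvGen.mono ?_ _ _ (Quotient.exact hpq)
  rintro p q ⟨α, hα, V, hV, γ, hγ, rfl, rfl⟩
  exact ⟨V, γ, hγ, rfl, rfl, fun t ht => proj_eq_of_isAction hα hV hγ ht,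
    fun t _ => (hQ.vertical _ _).2 ⟨α, hα, hV _⟩⟩

end Isotropy

theorem extDerivAt_zero_left {E : Type*} [NormedAddCommGroup E] [NormedSpace ℝ E]
    {M : Type*} [TopologicalSpace M] [ChartedSpace E M] (Ω : BilinField E M) (p : M) (v w : E) :
    extDerivAt Ω p 0 v w = 0 := by
  simp [extDerivAt, flatExtDeriv]

theorem IsComplexStructure.torsionAt_eq_zero {E : Type*} [NormedAddCommGroup E] [NormedSpace ℝ E]
    {M : Type*} [TopologicalSpace M] [ChartedSpace E M] [IsManifold 𝓘(ℝ, E) ∞ M]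
    {J : EndField E M} (h : IsComplexStructure J) (p : M) (u v : E) : torsionAt J p u v = 0 := by
  obtain ⟨X, hX, rfl⟩ := exists_smoothVFieldAt p u
  obtain ⟨Y, hY, rfl⟩ := exists_smoothVFieldAt p v
  exact (torsion_eq h.smooth hX hY).symm.trans (h.torsion_free p X Y hX hY)

universe u v in
-- Both identities are tensorial, so at a point of the base they may be checked on images of vectors
-- upstairs, where they hold.
theorem IsComplexStructure.of_submersion {E₁ : Type u} [NormedAddCommGroup E₁] [NormedSpace ℝ E₁]
    {M₁ : Type*} [TopologicalSpace M₁] [ChartedSpace E₁ M₁] [IsManifold 𝓘(ℝ, E₁) ∞ M₁]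
    {E₂ : Type v} [NormedAddCommGroup E₂] [NormedSpace ℝ E₂] [FiniteDimensional ℝ E₂]
    {M₂ : Type*} [TopologicalSpace M₂] [ChartedSpace E₂ M₂] [IsManifold 𝓘(ℝ, E₂) ∞ M₂]
    {π : M₁ → M₂} (hπ : IsSubmersion 𝓘(ℝ, E₁) 𝓘(ℝ, E₂) ∞ π) (hsurj : Function.Surjective π)
    {J₁ : EndField E₁ M₁} {J₂ : EndField E₂ M₂} (h₁ : IsComplexStructure J₁)
    (h : Intertwines J₁ J₂ π) : IsComplexStructure J₂ := by
  have hd := fun p => dmap_surjective_of_isSubmersionAt (hπ.isSubmersionAt p)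
  have hsm := SmoothEnd.of_submersion hπ hsurj h₁.smooth h
  refine ⟨hsm, fun z v => ?_, fun z X Y hX hY => ?_⟩
  · obtain ⟨p, rfl⟩ := hsurj z
    obtain ⟨v, rfl⟩ := hd p v
    rw [← h, ← h, h₁.sq, map_neg]
  · obtain ⟨p, rfl⟩ := hsurj z
    refine (torsion_eq hsm hX hY).trans ?_
    obtain ⟨u, hu⟩ := hd p (X (π p))
    obtain ⟨v, hv⟩ := hd p (Y (π p))
    rw [← hu, ← hv]
    refine (torsionAt_of_intertwines hπ.contMDiff h₁.smooth hsm h p u v).symm.trans ?_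
    exact (congrArg (dmap E₁ E₂ π p) (h₁.torsionAt_eq_zero p u v)).trans (map_zero _)

/-! ### The complex structure and the kernel of the two-form on the level set. -/

section LevelSetGeometry

universe u v
variable {EM : Type*} [NormedAddCommGroup EM] [NormedSpace ℝ EM] [FiniteDimensional ℝ EM]
  {M : Type*} [TopologicalSpace M] [ChartedSpace EM M] [IsManifold 𝓘(ℝ, EM) ∞ M]
  {𝒥 : GenEnd EM M}
  {ES : Type u} [NormedAddCommGroup ES] [NormedSpace ℝ ES] [FiniteDimensional ℝ ES]
  {S : Type*} [TopologicalSpace S] [ChartedSpace ES S] [IsManifold 𝓘(ℝ, ES) ∞ S]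
  {Ω : BilinField ES S} {a : EndField ES S} {μ : S → M}
  {x : M} {EC : Type v} [NormedAddCommGroup EC] [NormedSpace ℝ EC] [FiniteDimensional ℝ EC]
  [ChartedSpace EC (μ ⁻¹' {x})] [IsManifold 𝓘(ℝ, EC) ∞ (μ ⁻¹' {x})]

omit [FiniteDimensional ℝ ES] [IsManifold 𝓘(ℝ, ES) ∞ S] in
theorem compA_hitchinGen (p : S) (v : Tan ES p) : compA (hitchinGen Ω a) p v = a p v := by
  simp [compA, hitchinGen]

omit [FiniteDimensional ℝ ES] [IsManifold 𝓘(ℝ, ES) ∞ S] in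
theorem compPi_hitchinGen (p : S) (ξ : Cot ES p) :
    compPi (hitchinGen Ω a) p ξ = inversePi Ω p ξ := by
  simp [compPi, hitchinGen]

omit [FiniteDimensional ℝ ES] [IsManifold 𝓘(ℝ, ES) ∞ S] in
theorem compSigma_hitchinGen (p : S) (v : Tan ES p) :
    compSigma (hitchinGen Ω a) p v = twist Ω a p v := by
  simp [compSigma, hitchinGen]

theorem IsSymplectic.inversePi_apply (h : IsSymplectic Ω) (p : S) (v : Tan ES p) :
    inversePi Ω p (Ω p v) = v :=
  (isInvertible_of_nondegenerate (E := ES) (T := Ω p) (h.nondegenerate p)).inverse_apply_self v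

omit [FiniteDimensional ℝ EM] [FiniteDimensional ℝ ES] [IsManifold 𝓘(ℝ, EM) ∞ M] in
theorem IsHitchinRealization.map_end (hμ : IsHitchinRealization Ω a 𝒥 μ) (p : S) (v : Tan ES p)
    (hv : dmap ES EM μ p v = 0) : dmap ES EM μ p (a p v) = 0 := by
  rw [← compA_hitchinGen (Ω := Ω), hμ.holomorphic.map_a, hv, map_zero]

omit [FiniteDimensional ℝ EM] [FiniteDimensional ℝ ES] [IsManifold 𝓘(ℝ, EM) ∞ M] in
theorem IsHitchinRealization.pull_twist (hμ : IsHitchinRealization Ω a 𝒥 μ) (p : S)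
    (v w : Tan ES p) : pullForm μ (compSigma 𝒥) p v w = twist Ω a p v w := by
  rw [← compSigma_hitchinGen]
  exact hμ.holomorphic.pull_sigma p v w

omit [FiniteDimensional ℝ EM] [IsManifold 𝓘(ℝ, EM) ∞ M] [FiniteDimensional ℝ ES] in
-- The twist is pulled back from `M`, so it vanishes on `v`: `Ω(v, w) + Ω(av, aw) = 0`. Commutation
-- rewrites this as `Ω(a²v + v, w) = 0` for all `w`.
theorem IsHitchinRealization.end_end (hμ : IsHitchinRealization Ω a 𝒥 μ) (p : S) (v : Tan ES p)
    (hv : dmap ES EM μ p v = 0) : a p (a p v) = -v := by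
  have h1 : ∀ w, Ω p (a p (a p v) + v) w = 0 := by
    intro w
    have h2 := hμ.pull_twist p v w
    rw [pullForm, hv, twist_apply, ← hμ.hitchin.commutes] at h2
    simp only [map_zero, _root_.zero_apply] at h2
    rw [map_add, _root_.add_apply]
    linarith
  exact eq_neg_of_add_eq_zero_left (hμ.hitchin.symplectic.nondegenerate p _ h1)

omit [FiniteDimensional ℝ EM] in
-- Paired with `w` by `Ω`, the torsion is the exterior derivative of the twist, that is, the
-- pull-back of `dσ_M`, and one of its arguments maps to zero. A single argument in `Ker dμ` is
-- enough.
theorem IsHitchinRealization.torsionAt_eq_zero (hμ : IsHitchinRealization Ω a 𝒥 μ)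
    (hσ : SmoothBilin (compSigma 𝒥)) (p : S) (hs : Function.Surjective (dmap ES EM μ p))
    (u v : ES) (hu : dmap ES EM μ p u = 0) :
    torsionAt (E := ES) a p u v = 0 := by
  have hτ : SmoothBilin (twist Ω a) := hσ.pullback hμ.smooth hμ.pull_twist
  have hsk := hμ.hitchin.symplectic.skew
  refine hμ.hitchin.symplectic.nondegenerate p _ fun w => ?_
  refine (hμ.hitchin.apply_torsionAt hτ p u v w).trans ?_
  have h1 := extDerivAt_pullForm hμ.smooth hτ hσ hμ.pull_twist p (fun v w => by
    -- Skewness of `σ_M` at `μ p` is read off from the twist, since `dμ` is onto.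
    obtain ⟨v, rfl⟩ := hs v
    obtain ⟨w, rfl⟩ := hs w
    refine (hμ.pull_twist p v w).trans (Eq.trans ?_ (congrArg Neg.neg (hμ.pull_twist p w v).symm))
    rw [twist_apply, twist_apply, hsk p v w, hsk p (a p v)]
    ring) u v w
  rw [h1, hu]
  exact extDerivAt_zero_left _ _ _ _

omit [IsManifold 𝓘(ℝ, EM) ∞ M] [FiniteDimensional ℝ EC] [IsManifold 𝓘(ℝ, EC) ∞ (μ ⁻¹' {x})] in
theorem IsHitchinRealization.exists_end (hμ : IsHitchinRealization Ω a 𝒥 μ)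
    (hx : IsRegularValue ES EM μ x)
    (hC : IsSmoothEmbedding 𝓘(ℝ, EC) 𝓘(ℝ, ES) ∞ (incl μ x)) :
    ∃ aC : EndField EC (μ ⁻¹' {x}), Intertwines aC a (incl μ x) := by
  refine exists_restricted_end (fun p => dmap_injective_of_isImmersionAt
    (hC.isImmersion.isImmersionAt p)) fun p v => ?_
  exact exists_dmap_incl_eq hμ.smooth p (hx p p.2) (hC.isImmersion.isImmersionAt p) _
    (hμ.map_end _ _ (dmap_dmap_incl hμ.smooth hC.isImmersion.contMDiff p v))

omit [FiniteDimensional ℝ EM] in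
-- The differential of the inclusion is injective, so both identities may be checked in `S` on
-- vectors of `Ker dμ`.
theorem IsHitchinRealization.isComplexStructure (hμ : IsHitchinRealization Ω a 𝒥 μ)
    (hσ : SmoothBilin (compSigma 𝒥)) (hx : IsRegularValue ES EM μ x)
    (hC : IsSmoothEmbedding 𝓘(ℝ, EC) 𝓘(ℝ, ES) ∞ (incl μ x))
    {aC : EndField EC (μ ⁻¹' {x})} (h : Intertwines aC a (incl μ x)) : IsComplexStructure aC := by
  have hinj := fun p => dmap_injective_of_isImmersionAt (hC.isImmersion.isImmersionAt p)
  have hsm := SmoothEnd.of_immersion hC.isImmersion hμ.hitchin.smooth h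
  have hk := dmap_dmap_incl hμ.smooth hC.isImmersion.contMDiff
  refine ⟨hsm, fun p v => hinj p ?_, fun p X Y hX hY => ?_⟩
  · rw [h, h, map_neg]
    exact hμ.end_end _ _ (hk p v)
  · refine (torsion_eq hsm hX hY).trans (hinj p ?_)
    refine (torsionAt_of_intertwines hC.isImmersion.contMDiff hsm hμ.hitchin.smooth h p _ _).trans ?_
    exact (hμ.torsionAt_eq_zero hσ _ (hx p p.2) _ _ (hk p _)).trans (map_zero _).symm

omit [IsManifold 𝓘(ℝ, EM) ∞ M] [FiniteDimensional ℝ EC] [IsManifold 𝓘(ℝ, EC) ∞ (μ ⁻¹' {x})] in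
/-- The vertical vectors are the kernel of the restriction of the symplectic form. -/
theorem IsHitchinRealization.dmap_proj_eq_zero_iff (hμ : IsHitchinRealization Ω a 𝒥 μ)
    (hx : IsRegularValue ES EM μ x)
    (hC : IsSmoothEmbedding 𝓘(ℝ, EC) 𝓘(ℝ, ES) ∞ (incl μ x))
    {EQ : Type*} [NormedAddCommGroup EQ] [NormedSpace ℝ EQ]
    [ChartedSpace EQ (OrbitSpace EC Ω 𝒥 μ x)]
    (hQ : IsSmoothQuotient (EC := EC) (EQ := EQ) Ω 𝒥 μ x) (p : μ ⁻¹' {x}) (v : Tan EC p) :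
    dmap EC EQ (proj EC Ω 𝒥 μ x) p v = 0 ↔
      ∀ w : Tan EC p, pullForm (incl μ x) Ω p v w = 0 := by
  have hk := dmap_dmap_incl hμ.smooth hC.isImmersion.contMDiff (p := p)
  refine (hQ.vertical p v).trans ⟨?_, fun h => ?_⟩
  · rintro ⟨α, -, h⟩ w
    rw [IsAction] at h
    rw [pullForm, h, ContinuousLinearMap.comp_apply, hk, map_zero]
  -- The covector `Ω(v, ·)` vanishes on the tangent space of `𝒞`, which is `Ker dμ`, so it factors
  -- through `dμ`.
  · obtain ⟨ξ, hξ⟩ : ∃ ξ : Cot EM (μ (p : S)), Ω (p : S) (dmap EC ES (incl μ x) p v)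
        = ξ.comp (dmap ES EM μ (p : S)) := by
      refine exists_clm_comp_eq (E := ES) (F := EM) (hx p p.2) fun w hw => ?_
      obtain ⟨w, rfl⟩ := exists_dmap_incl_eq hμ.smooth p (hx p p.2)
        (hC.isImmersion.isImmersionAt p) w hw
      exact h w
    -- `π^♯ ξ = dμ(Ω⁻¹(ξ ∘ dμ)) = dμ(v) = 0`, so `ξ` belongs to the isotropy algebra.
    have h1 := hμ.holomorphic.map_pi p ξ
    rw [← hξ, compPi_hitchinGen, hμ.hitchin.symplectic.inversePi_apply, hk] at h1
    obtain ⟨α, hα, rfl⟩ := exists_covectorAt_eq 𝒥 p ξ h1.symm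
    exact ⟨α, hα, hξ⟩

end LevelSetGeometry

/-! ### Reduced forms on the orbit space. -/

section Reduced

/-- The pull-back of a field of bilinear forms, as a field of bilinear forms. -/
def pullBilin {E₁ : Type*} [NormedAddCommGroup E₁] [NormedSpace ℝ E₁] {M₁ : Type*}
    [TopologicalSpace M₁] [ChartedSpace E₁ M₁] {E₂ : Type*} [NormedAddCommGroup E₂]
    [NormedSpace ℝ E₂] {M₂ : Type*} [TopologicalSpace M₂] [ChartedSpace E₂ M₂]
    (f : M₁ → M₂) (Ω : BilinField E₂ M₂) : BilinField E₁ M₁ := fun p =>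
  (ContinuousLinearMap.precomp ℝ (show E₁ →L[ℝ] E₂ from dmap E₁ E₂ f p)).comp
    ((show E₂ →L[ℝ] E₂ →L[ℝ] ℝ from Ω (f p)).comp (show E₁ →L[ℝ] E₂ from dmap E₁ E₂ f p))

universe u v w
variable {EM : Type*} [NormedAddCommGroup EM] [NormedSpace ℝ EM]
  {M : Type*} [TopologicalSpace M] [ChartedSpace EM M]
  {𝒥 : GenEnd EM M}
  {ES : Type u} [NormedAddCommGroup ES] [NormedSpace ℝ ES]
  {S : Type*} [TopologicalSpace S] [ChartedSpace ES S] [IsManifold 𝓘(ℝ, ES) ∞ S]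
  {Ω : BilinField ES S} {a : EndField ES S} {μ : S → M}
  {x : M} {EC : Type v} [NormedAddCommGroup EC] [NormedSpace ℝ EC] [FiniteDimensional ℝ EC]
  [ChartedSpace EC (μ ⁻¹' {x})] [IsManifold 𝓘(ℝ, EC) ∞ (μ ⁻¹' {x})]
  {EQ : Type w} [NormedAddCommGroup EQ] [NormedSpace ℝ EQ] [FiniteDimensional ℝ EQ]
  [ChartedSpace EQ (OrbitSpace EC Ω 𝒥 μ x)] [IsManifold 𝓘(ℝ, EQ) ∞ (OrbitSpace EC Ω 𝒥 μ x)]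

/-- A closed two-form whose restriction to the level set has the vertical vectors in its kernel
descends to a closed two-form on the orbit space. -/
theorem IsSmoothQuotient.exists_reduced_form
    (hQ : IsSmoothQuotient (EC := EC) (EQ := EQ) Ω 𝒥 μ x)
    (hC : ContMDiff 𝓘(ℝ, EC) 𝓘(ℝ, ES) ∞ (incl μ x)) {B : BilinField ES S} (hB : SmoothBilin B)
    (hskew : ∀ (p : S) (v w : Tan ES p), B p v w = - B p w v) (hcl : IsClosedForm B)
    (hker : ∀ (p : μ ⁻¹' {x}) (k w : Tan EC p), dmap EC EQ (proj EC Ω 𝒥 μ x) p k = 0 →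
      pullForm (incl μ x) B p k w = 0) :
    ∃ B' : BilinField EQ (OrbitSpace EC Ω 𝒥 μ x), SmoothBilin B' ∧ IsClosedForm B' ∧
      (∀ z (v w : Tan EQ z), B' z v w = - B' z w v) ∧ ∀ (p : μ ⁻¹' {x}) (v w : Tan EC p),
        pullForm (proj EC Ω 𝒥 μ x) B' p v w = pullForm (incl μ x) B p v w := by
  have hsurj : Function.Surjective (proj EC Ω 𝒥 μ x) := Quotient.mk_surjective
  have hd := fun p => dmap_surjective_of_isSubmersionAt (hQ.submersion.isSubmersionAt p)
  have hθ' : ∀ (p : μ ⁻¹' {x}) (v w : Tan EC p), pullForm (incl μ x) B p v w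
    = pullBilin (incl μ x) B p v w := fun p v w => rfl
  have hθ : SmoothBilin (pullBilin (E₁ := EC) (incl μ x) B) := hB.pullback hC hθ'
  have hsk : ∀ (p : μ ⁻¹' {x}) (v w : Tan EC p),
    pullBilin (incl μ x) B p v w = - pullBilin (incl μ x) B p w v := fun p v w => hskew _ _ _
  have hdθ : ∀ (p : μ ⁻¹' {x}) (u v w : EC),
      extDerivAt (pullBilin (E₁ := EC) (incl μ x) B) p u v w = 0 := fun p u v w =>
    (extDerivAt_pullForm hC hθ hB hθ' p (hskew _) u v w).trans
      ((isClosedForm_iff_extDerivAt hB hskew).1 hcl _ _ _ _)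
  obtain ⟨B', hB'⟩ := exists_descended_form hQ.submersion hsurj hθ hsk hdθ hker
    (eqvGen_vertical_curves hQ)
  have hsm : SmoothBilin B' := hθ.of_pullback hQ.submersion hsurj hB'
  have hsk' : ∀ z (v w : Tan EQ z), B' z v w = - B' z w v := by
    intro z v w
    obtain ⟨p, rfl⟩ := hsurj z
    obtain ⟨v, rfl⟩ := hd p v
    obtain ⟨w, rfl⟩ := hd p w
    exact (hB' p v w).trans ((hsk p v w).trans (congrArg Neg.neg (hB' p w v).symm))
  refine ⟨B', hsm, (isClosedForm_iff_extDerivAt hsm hsk').2 fun z u v w => ?_, hsk', hB'⟩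
  obtain ⟨p, rfl⟩ := hsurj z
  obtain ⟨u, rfl⟩ := hd p u
  obtain ⟨v, rfl⟩ := hd p v
  obtain ⟨w, rfl⟩ := hd p w
  exact (extDerivAt_pullForm hQ.submersion.contMDiff hθ hsm hB' p (hsk' _) u v w).symm.trans
    (hdθ p u v w)

end Reduced

end HitchinReduction

end

/-! ### The reduction theorem. -/

theorem mainTheorem7
    -- the generalized complex manifold `(M, 𝒥)`
    {EM : Type*} [NormedAddCommGroup EM] [NormedSpace ℝ EM] [FiniteDimensional ℝ EM]
    {M : Type*} [TopologicalSpace M] [T2Space M] [SecondCountableTopology M]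
    [ChartedSpace EM M] [IsManifold 𝓘(ℝ, EM) ∞ M]
    (𝒥 : GenEnd EM M) (h𝒥 : IsGenComplex 𝒥)
    -- the Hitchin realization `μ : (S, Ω, a) → (M, 𝒥)`
    {ES : Type*} [NormedAddCommGroup ES] [NormedSpace ℝ ES] [FiniteDimensional ℝ ES]
    {S : Type*} [TopologicalSpace S] [T2Space S] [SecondCountableTopology S]
    [ChartedSpace ES S] [IsManifold 𝓘(ℝ, ES) ∞ S]
    (Ω : BilinField ES S) (a : EndField ES S) (μ : S → M)
    (hμ : IsHitchinRealization Ω a 𝒥 μ)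
    -- the regular value `x` and the embedded submanifold `𝒞 = μ⁻¹(x)`
    (x : M) (hx : IsRegularValue ES EM μ x)
    {EC : Type*} [NormedAddCommGroup EC] [NormedSpace ℝ EC] [FiniteDimensional ℝ EC]
    [ChartedSpace EC (μ ⁻¹' {x})] [IsManifold 𝓘(ℝ, EC) ∞ (μ ⁻¹' {x})]
    (hC : IsSmoothEmbedding 𝓘(ℝ, EC) 𝓘(ℝ, ES) ∞ (incl μ x))
    -- the orbit space `𝒞/𝔤_x` is smooth
    {EQ : Type*} [NormedAddCommGroup EQ] [NormedSpace ℝ EQ] [FiniteDimensional ℝ EQ]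
    [T2Space (OrbitSpace EC Ω 𝒥 μ x)] [ChartedSpace EQ (OrbitSpace EC Ω 𝒥 μ x)]
    [IsManifold 𝓘(ℝ, EQ) ∞ (OrbitSpace EC Ω 𝒥 μ x)]
    (hQ : IsSmoothQuotient (EC := EC) (EQ := EQ) Ω 𝒥 μ x) :
    -- `a` restricts to a complex structure `aC` on `𝒞`
    ∃ aC : EndField EC (μ ⁻¹' {x}), IsComplexStructure aC ∧ Intertwines aC a (incl μ x) ∧
      -- the reduced symplectic form on `𝒞/𝔤_x`
      ∃ ΩC : BilinField EQ (OrbitSpace EC Ω 𝒥 μ x),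
        (IsSymplectic ΩC ∧ ∀ (p : μ ⁻¹' {x}) (v w : Tan EC p),
          pullForm (proj EC Ω 𝒥 μ x) ΩC p v w = pullForm (incl μ x) Ω p v w) ∧
        (∀ Ω' : BilinField EQ (OrbitSpace EC Ω 𝒥 μ x),
          (∀ (p : μ ⁻¹' {x}) (v w : Tan EC p),
            pullForm (proj EC Ω 𝒥 μ x) Ω' p v w = pullForm (incl μ x) Ω p v w) → Ω' = ΩC) ∧
        -- the complex structure on `𝒞/𝔤_x`
        ∃ JC : EndField EQ (OrbitSpace EC Ω 𝒥 μ x),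
          (IsComplexStructure JC ∧ Intertwines aC JC (proj EC Ω 𝒥 μ x)) ∧
          (∀ J' : EndField EQ (OrbitSpace EC Ω 𝒥 μ x),
            IsComplexStructure J' → Intertwines aC J' (proj EC Ω 𝒥 μ x) → J' = JC) ∧
          Commutes ΩC JC := by
  have hsurj : Function.Surjective (proj EC Ω 𝒥 μ x) := Quotient.mk_surjective
  have hd := fun p => dmap_surjective_of_isSubmersionAt (hQ.submersion.isSubmersionAt p)
  have hs := hμ.hitchin.symplectic
  have hvert := hμ.dmap_proj_eq_zero_iff hx hC hQ
  obtain ⟨aC, haC⟩ := hμ.exists_end hx hC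
  have hcx := hμ.isComplexStructure h𝒥.smooth_sigma hx hC haC
  obtain ⟨ΩC, hΩsm, hΩcl, hΩsk, hΩC⟩ := hQ.exists_reduced_form hC.isImmersion.contMDiff hs.smooth
    hs.skew hs.closed fun p k w hk => (hvert p k).1 hk w
  -- The reduction of `Ω_a`. It annihilates vertical `k` because `Ω(ak, w) = Ω(k, aw)` and `aw` is
  -- again tangent to `𝒞`.
  obtain ⟨BC, -, -, hBsk, hBC⟩ := hQ.exists_reduced_form hC.isImmersion.contMDiff
    (hs.smooth.comp_end hμ.hitchin.smooth) (hμ.hitchin.commutes.skew hs.skew) hμ.hitchin.closed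
    fun p k w hk => by
      refine (hμ.hitchin.commutes _ _ _).trans ?_
      rw [← haC]
      exact (hvert p k).1 hk _
  have hnd : ∀ z (v : Tan EQ z), (∀ w : Tan EQ z, ΩC z v w = 0) → v = 0 := by
    intro z v hv
    obtain ⟨p, rfl⟩ := hsurj z
    obtain ⟨v, rfl⟩ := hd p v
    exact (hvert p v).2 fun w => (hΩC p v w).symm.trans (hv _)
  have hsymp : IsSymplectic ΩC :=
    ⟨hΩsm, fun z v => self_eq_neg.1 (hΩsk z v v), hnd, hΩcl⟩
  -- On `S` the tensor `a` is recovered as `Ω⁻¹ Ω_a`; the same formula defines the reduced tensor.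
  let JC : EndField EQ (OrbitSpace EC Ω 𝒥 μ x) := fun z => (inversePi ΩC z).comp (BC z)
  have hJ : ∀ z (v w : Tan EQ z), ΩC z (JC z v) w = BC z v w := fun z v w =>
    congrArg (fun T : EQ →L[ℝ] ℝ => T w)
      ((isInvertible_of_nondegenerate (E := EQ) (T := ΩC z) (hnd z)).self_apply_inverse (BC z v))
  have hint : Intertwines aC JC (proj EC Ω 𝒥 μ x) := by
    intro p v
    refine sub_eq_zero.1 (hnd _ _ fun w => ?_)
    obtain ⟨w, rfl⟩ := hd p w
    rw [map_sub, _root_.sub_apply, sub_eq_zero, hJ]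
    refine (hΩC p _ w).trans (Eq.trans ?_ (hBC p v w).symm)
    rw [pullForm, haC]
    rfl
  refine ⟨aC, hcx, haC, ΩC, ⟨hsymp, hΩC⟩, fun Ω' h' => eq_of_pullForm_eq hsurj hd fun p v w =>
    (h' p v w).trans (hΩC p v w).symm, JC, ⟨hcx.of_submersion hQ.submersion hsurj hint, hint⟩,
    fun J' _ h' => eq_of_intertwines hsurj hd h' hint, fun z v w => ?_⟩
  -- Skewness of `B_𝒞` and `Ω_𝒞`: `Ω(Jv, w) = B(v, w) = -B(w, v) = -Ω(Jw, v) = Ω(v, Jw)`.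
  rw [hJ, hBsk, ← hJ, hΩsk z v]
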